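/- Let $M$ be a closed smooth manifold (compact, Hausdorff, without boundary) of dimension $n$. A *Morse function* on $M$ is a smooth function $f:M\to\mathbb R$ all of whose critical points are non-degenerate. A *pseudo-gradient* of $f$ is a smooth vector field $X$ on $M$ such that $X\cdot f<0$ outside the critical locus of $f$ and such that the Hessian of $X\cdot f$ at each critical point of $f$ is negative definite. An orbit of $X$ *connects* $p$ to $q$ if it tends to $p$ as $t\to-\infty$ and to $q$ as $t\to+\infty$. A Morse function $f$ is *ordered* if $\operatorname{index}(p)<\operatorname{index}(q)$ implies $f(p)<f(q)$ for all critical points $p,q$, and *self-indexing* if $f(p)=\operatorname{index}(p)$ for every critical point $p$. Let $f_0$ be a Morse function on $M$ with a pseudo-gradient $X$, and suppose that, whenever $j>i$, no orbit of $X$ connects a critical point of index $i$ to a critical point of index $j$. Then: 1. There is a path $(f_t)_{t\in[0,1]}$ of Morse functions, starting at $f_0$ and smooth in $(t,x)\in[0,1]\times M$, such that $X$ is a pseudo-gradient of $f_t$ for every $t\in[0,1]$ and $f_1$ is ordered. 2. There is such a path with $f_1$ self-indexing if and only if no orbit of $X$ connects two distinct critical points of the same index. -/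

import Mathlib

open scoped Manifold ContDiff Topology

section MorseTheory

variable {n : ℕ} {M : Type*} [TopologicalSpace M] [ChartedSpace (EuclideanSpace ℝ (Fin n)) M]

/-- `p` is a critical point of the (smooth) function `f`. -/
def IsCritical (n : ℕ) {M : Type*} [TopologicalSpace M]
    [ChartedSpace (EuclideanSpace ℝ (Fin n)) M] (f : M → ℝ) (p : M) : Prop :=
  mfderiv (𝓡 n) 𝓘(ℝ, ℝ) f p = 0

/-- The Hessian of `f` at `p`: the second derivative at `p` of `f` read in the preferred chart
at `p`, which is the chart that Mathlib uses to identify the tangent space at `p` with the model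
space. At critical points this is the intrinsic Hessian. -/
noncomputable def hessianAt (n : ℕ) {M : Type*} [TopologicalSpace M]
    [ChartedSpace (EuclideanSpace ℝ (Fin n)) M] (f : M → ℝ) (p : M) :
    EuclideanSpace ℝ (Fin n) →L[ℝ] EuclideanSpace ℝ (Fin n) →L[ℝ] ℝ :=
  fderiv ℝ (fderiv ℝ (f ∘ (extChartAt (𝓡 n) p).symm)) (extChartAt (𝓡 n) p p)

/-- A Morse function: a smooth function all of whose critical points are non-degenerate. -/
def IsMorse (n : ℕ) {M : Type*} [TopologicalSpace M]
    [ChartedSpace (EuclideanSpace ℝ (Fin n)) M] (f : M → ℝ) : Prop :=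
  ContMDiff (𝓡 n) 𝓘(ℝ, ℝ) ∞ f ∧
    ∀ p, IsCritical n f p → ∀ v, (∀ w, hessianAt n f p v w = 0) → v = 0

/-- The index of `f` at `p`: the largest dimension of a subspace on which the Hessian of `f` at
`p` is negative definite. -/
noncomputable def morseIndex (n : ℕ) {M : Type*} [TopologicalSpace M]
    [ChartedSpace (EuclideanSpace ℝ (Fin n)) M] (f : M → ℝ) (p : M) : ℕ :=
  sigNeg (hessianAt n f p).toBilinForm.toQuadraticMap

/-- The derivative `X · f` of the function `f` along the vector field `X`. -/
noncomputable def vectorDeriv (X : ∀ x : M, TangentSpace (𝓡 n) x) (f : M → ℝ) : M → ℝ :=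
  fun x => (mfderiv (𝓡 n) 𝓘(ℝ, ℝ) f x : TangentSpace (𝓡 n) x →L[ℝ] ℝ) (X x)

/-- `X` is a pseudo-gradient of `f`: a smooth vector field such that `X · f` is negative outside
the critical locus of `f` and has negative definite Hessian at each critical point of `f`. -/
structure IsPseudoGradient [IsManifold (𝓡 n) ∞ M] (X : ∀ x : M, TangentSpace (𝓡 n) x)
    (f : M → ℝ) : Prop where
  smooth : ContMDiff (𝓡 n) (𝓡 n).tangent ∞ (fun x => (⟨x, X x⟩ : TangentBundle (𝓡 n) M))
  neg : ∀ x, ¬ IsCritical n f x → vectorDeriv X f x < 0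
  hessian_neg : ∀ p, IsCritical n f p → ∀ v, v ≠ 0 → hessianAt n (vectorDeriv X f) p v v < 0

/-- Some orbit of `X` goes from `p` (as time tends to `-∞`) to `q` (as time tends to `+∞`). -/
def HasConnectingOrbit (X : ∀ x : M, TangentSpace (𝓡 n) x) (p q : M) : Prop :=
  ∃ γ : ℝ → M, IsMIntegralCurve (I := 𝓡 n) γ X ∧
    Filter.Tendsto γ Filter.atBot (𝓝 p) ∧ Filter.Tendsto γ Filter.atTop (𝓝 q)

/-- The order of the critical values is finer than the order of the indices. -/
def IsOrdered (n : ℕ) {M : Type*} [TopologicalSpace M]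
    [ChartedSpace (EuclideanSpace ℝ (Fin n)) M] (f : M → ℝ) : Prop :=
  ∀ p q, IsCritical n f p → IsCritical n f q → morseIndex n f p < morseIndex n f q → f p < f q

/-- The value at each critical point is its index. -/
def IsSelfIndexing (n : ℕ) {M : Type*} [TopologicalSpace M]
    [ChartedSpace (EuclideanSpace ℝ (Fin n)) M] (f : M → ℝ) : Prop :=
  ∀ p, IsCritical n f p → f p = morseIndex n f p

/-- A smooth path `(f t)`, `t ∈ [0, 1]`, of Morse functions on `M` which all have `X` as
pseudo-gradient. -/
structure IsMorsePath [IsManifold (𝓡 n) ∞ M] (X : ∀ x : M, TangentSpace (𝓡 n) x)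
    (f : ℝ → M → ℝ) : Prop where
  smooth : ContMDiffOn (𝓘(ℝ, ℝ).prod (𝓡 n)) 𝓘(ℝ, ℝ) ∞ (fun z : ℝ × M => f z.1 z.2)
    (Set.Icc 0 1 ×ˢ Set.univ)
  morse : ∀ t ∈ Set.Icc (0 : ℝ) 1, IsMorse n (f t)
  pseudoGradient : ∀ t ∈ Set.Icc (0 : ℝ) 1, IsPseudoGradient X (f t)

end MorseTheory

/-!
The pseudo-gradient `X` determines both the critical points of `f₀` (they are its zeros) and their
indices: at a critical point, the Hessian `H` of `f₀` and the linear part `A` of `X` satisfy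
`H(v, A v) < 0` for `v ≠ 0`. For two functions with pseudo-gradient `X` this inequality holds along
the segment between their Hessians, which therefore consists of nondegenerate forms, and the index
is constant on it (`IsPseudoGradient.morseIndex_eq`). Since moreover functions decrease along the
orbits of their pseudo-gradients, a self-indexing function at the end of a path excludes orbits
between distinct critical points of equal index.

For the existence statements, let `g` be a smooth function with `X · g ≤ 0` which is constant near
each critical point. Then `ε f₀ + g` is a Morse function with pseudo-gradient `X` for every `ε > 0`
(`IsPseudoGradient.const_mul_add`), and a segment joins `f₀` to it. The critical values of `g` can
be prescribed arbitrarily, provided that they do not increase along connecting orbits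
(`IsPseudoGradient.exists_of_values`). For an ordered function, `ε = 1` and the values of `g` are a
large multiple of the index; for a self-indexing one, `ε` is small and the values are
`index - ε f₀`.

To construct `g`, it suffices to treat the values `0` and `1`, that is, a set `D` of critical points
that is closed under connecting orbits. Limits of orbits are broken orbits, so that an orbit which
starts close to `D` does not come close to the other critical points
(`IsGradientLike.mem_of_mem_prolongation`). The points on forward orbits from a small neighbourhood
of `D` thus form an open set `V` which contains `D`, whose closure avoids the other critical points,
and which the flow `φ` traps: `φ_T` maps the closure of `V` into `V` for some `T > 0`. A smooth
function `h` that is `0` near `φ_T (closure V)` and `1` near the complement of `V` satisfies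
`h ∘ φ_T ≤ h`, and its mean `g` over the orbit segments of length `T` satisfies
`X · g = (h ∘ φ_T - h) / T ≤ 0`. This mean is smooth because the flow is, which follows from the
implicit function theorem in the Banach space of continuous curves (`exists_contDiffAt_solution`).
-/

/-! ### Composition operators on spaces of continuous maps -/

section Nemytskii
open Set Filter
universe u

variable {K : Type*} [TopologicalSpace K] [CompactSpace K]

/-- The pointwise application of a continuous family of operators to a continuous family of
vectors, as a continuous bilinear map. -/
noncomputable def ContinuousMap.pointwiseApply (K : Type*) [TopologicalSpace K] [CompactSpace K]
    (E F : Type*) [NormedAddCommGroup E] [NormedSpace ℝ E]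
    [NormedAddCommGroup F] [NormedSpace ℝ F] :
    C(K, E →L[ℝ] F) →L[ℝ] C(K, E) →L[ℝ] C(K, F) :=
  LinearMap.mkContinuous₂
    (LinearMap.mk₂ ℝ
      (fun (A : C(K, E →L[ℝ] F)) (η : C(K, E)) => (⟨fun t => A t (η t), by fun_prop⟩ : C(K, F)))
      (fun A B η => by ext; simp) (fun c A η => by ext; simp)
      (fun A η ξ => by ext; simp) (fun c A η => by ext; simp)) 1
    (fun A η => by
      rw [one_mul]
      refine (ContinuousMap.norm_le _ (by positivity)).2 fun t => ?_
      exact ((A t).le_opNorm _).trans (by gcongr <;> exact ContinuousMap.norm_coe_le_norm _ t))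

@[simp] theorem ContinuousMap.pointwiseApply_apply {E F : Type*} [NormedAddCommGroup E]
    [NormedSpace ℝ E] [NormedAddCommGroup F] [NormedSpace ℝ F] (A : C(K, E →L[ℝ] F)) (η : C(K, E))
    (t : K) : ContinuousMap.pointwiseApply K E F A η t = A t (η t) := rfl

/-- Composition with a `C^1` map is differentiable on the Banach space of continuous maps. -/
theorem ContinuousMap.hasFDerivAt_comp_left {E F : Type*} [NormedAddCommGroup E] [NormedSpace ℝ E]
    [NormedAddCommGroup F] [NormedSpace ℝ F] {v : E → F} {v' : E → E →L[ℝ] F}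
    (hv : ∀ x, HasFDerivAt v (v' x) x) (hc : Continuous v) (hc' : Continuous v') (γ : C(K, E)) :
    HasFDerivAt (fun γ : C(K, E) => (⟨v, hc⟩ : C(E, F)).comp γ)
      (ContinuousMap.pointwiseApply K E F ((⟨v', hc'⟩ : C(E, E →L[ℝ] F)).comp γ)) γ := by
  have hcont : Continuous (fun γ : C(K, E) => (⟨v', hc'⟩ : C(E, E →L[ℝ] F)).comp γ) :=
    ContinuousMap.continuous_postcomp _
  rw [hasFDerivAt_iff_isLittleO, Asymptotics.isLittleO_iff]
  intro c hc0
  obtain ⟨δ, hδ, hδc⟩ := Metric.continuous_iff (α := C(K, E)) (β := C(K, E →L[ℝ] F)) |>.1 hcont γ c hc0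
  filter_upwards [Metric.ball_mem_nhds γ hδ] with ζ hζ
  refine (ContinuousMap.norm_le _ (by positivity)).2 fun t => ?_
  have key : ∀ x ∈ segment ℝ (γ t) (ζ t), ‖v' x - v' (γ t)‖ ≤ c := by
    rintro x hx
    rw [segment_eq_image'] at hx
    obtain ⟨θ, hθ, rfl⟩ := hx
    have h1 : dist (γ + θ • (ζ - γ)) γ < δ := by
      rw [dist_eq_norm, add_sub_cancel_left, norm_smul, Real.norm_of_nonneg hθ.1]
      calc θ * ‖ζ - γ‖ ≤ 1 * ‖ζ - γ‖ := by gcongr; exact hθ.2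
        _ < δ := by rw [one_mul, ← dist_eq_norm]; exact hζ
    have h2 := (ContinuousMap.dist_apply_le_dist t).trans (hδc _ h1).le
    simpa [dist_eq_norm] using h2
  have hconv : Convex ℝ (segment ℝ (γ t) (ζ t)) := convex_segment _ _
  have := hconv.norm_image_sub_le_of_norm_hasFDerivWithin_le' (f := v) (f' := v') (φ := v' (γ t))
    (fun x _ => (hv x).hasFDerivWithinAt) key (left_mem_segment ℝ _ _) (right_mem_segment ℝ _ _)
  refine (le_trans ?_ this).trans ?_
  · simp
  · gcongr
    exact ContinuousMap.norm_coe_le_norm (ζ - γ) t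

/-- Composition with a `C^n` map is `C^n` on the Banach space of continuous maps on a compact
space. -/
theorem ContDiff.continuousMap_comp_left {E : Type u} [NormedAddCommGroup E] [NormedSpace ℝ E]
    (n : ℕ) {F : Type u} [NormedAddCommGroup F] [NormedSpace ℝ F] {v : E → F}
    (hv : ContDiff ℝ n v) (hc : Continuous v) :
    ContDiff ℝ n (fun γ : C(K, E) => (⟨v, hc⟩ : C(E, F)).comp γ) := by
  induction n generalizing F with
  | zero =>
    exact contDiff_zero.2 (ContinuousMap.continuous_postcomp _)
  | succ n ih =>
    have h1 : ContDiff ℝ n (fderiv ℝ v) := hv.fderiv_right (by norm_cast)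
    have hd : ∀ x, HasFDerivAt v (fderiv ℝ v x) x := fun x =>
      ((hv.differentiable (by norm_cast)) x).hasFDerivAt
    rw [show ((n + 1 : ℕ) : WithTop ℕ∞) = (n : WithTop ℕ∞) + 1 by norm_cast,
      contDiff_succ_iff_hasFDerivAt (n := n)]
    refine ⟨_, ?_, fun γ => ContinuousMap.hasFDerivAt_comp_left hd hc h1.continuous γ⟩
    exact (ContinuousMap.pointwiseApply K E F).contDiff.comp (ih h1 h1.continuous)

end Nemytskii

/-! ### Smooth dependence of solutions of differential equations on parameters -/

section LocalFlow
open Set Filter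

variable {E : Type*} [NormedAddCommGroup E] [NormedSpace ℝ E] 

/-- The primitive vanishing at `0` of a continuous curve on `[-1, 1]`, as an operator on the
Banach space of such curves. -/
noncomputable def curvePrimitive (E : Type*) [NormedAddCommGroup E] [NormedSpace ℝ E] :
    C(Icc (-1 : ℝ) 1, E) →L[ℝ] C(Icc (-1 : ℝ) 1, E) :=
  LinearMap.mkContinuous
    { toFun := fun η => ⟨fun t => ∫ r in (0 : ℝ)..t, IccExtend (by norm_num) η r, by
        have h : Continuous (IccExtend (by norm_num : (-1 : ℝ) ≤ 1) η) := η.continuous.Icc_extend'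
        exact (intervalIntegral.continuous_primitive (fun a b => h.intervalIntegrable a b) 0).comp
          continuous_subtype_val⟩
      map_add' := fun η ξ => by
        ext t
        have h (η : C(Icc (-1 : ℝ) 1, E)) : Continuous (IccExtend (by norm_num : (-1 : ℝ) ≤ 1) η) :=
          η.continuous.Icc_extend'
        exact intervalIntegral.integral_add ((h η).intervalIntegrable _ _)
          ((h ξ).intervalIntegrable _ _)
      map_smul' := fun c η => by
        ext t
        exact intervalIntegral.integral_smul c _ } 1
    (fun η => by
      rw [one_mul]
      refine (ContinuousMap.norm_le _ (by positivity)).2 fun t => ?_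
      refine (intervalIntegral.norm_integral_le_of_norm_le_const (C := ‖η‖) fun r _ => ?_).trans ?_
      · exact ContinuousMap.norm_coe_le_norm η _
      · rw [sub_zero]
        exact mul_le_of_le_one_right (norm_nonneg _) (abs_le.2 t.2))

theorem curvePrimitive_apply (η : C(Icc (-1 : ℝ) 1, E)) (t : Icc (-1 : ℝ) 1) :
    curvePrimitive E η t = ∫ r in (0 : ℝ)..t, IccExtend (by norm_num) η r := rfl

/-- Smooth dependence of the solutions of `γ' = s • v γ`, `γ 0 = x` on the parameters `(s, x)`
close to `(0, x₀)`: the integral equation is solved by the implicit function theorem in the Banach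
space of curves, starting from the constant curve that solves it for `s = 0`. -/
theorem exists_contDiffAt_solution {E : Type*} [NormedAddCommGroup E] [NormedSpace ℝ E]
    [CompleteSpace E]
    {n : ℕ} (hn : n ≠ 0) {v : E → E} (hv : ContDiff ℝ n v) (x₀ : E) :
    ∃ Γ : ℝ × E → C(Icc (-1 : ℝ) 1, E), ContDiffAt ℝ n Γ (0, x₀) ∧
      Γ (0, x₀) = ContinuousMap.const _ x₀ ∧
      ∀ᶠ z in 𝓝 ((0 : ℝ), x₀), ∀ t, Γ z t =
        z.2 + z.1 • curvePrimitive E ((⟨v, hv.continuous⟩ : C(E, E)).comp (Γ z)) t := by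
  let cst : E →L[ℝ] C(Icc (-1 : ℝ) 1, E) := ContinuousLinearMap.const ℝ _
  let N : C(Icc (-1 : ℝ) 1, E) → C(Icc (-1 : ℝ) 1, E) := fun γ =>
    (⟨v, hv.continuous⟩ : C(E, E)).comp γ
  have hN : ContDiff ℝ n N := hv.continuousMap_comp_left n hv.continuous
  let F : (ℝ × E) × C(Icc (-1 : ℝ) 1, E) → C(Icc (-1 : ℝ) 1, E) := fun w =>
    w.2 - cst w.1.2 - w.1.1 • curvePrimitive E (N w.2)
  have hF : ContDiff ℝ n F := by
    refine (contDiff_snd.sub (cst.contDiff.comp (contDiff_snd.comp contDiff_fst))).sub ?_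
    exact (contDiff_fst.comp contDiff_fst).smul
      ((curvePrimitive E).contDiff.comp (hN.comp contDiff_snd))
  have hn' : (n : WithTop ℕ∞) ≠ 0 := by exact_mod_cast hn
  let u : (ℝ × E) × C(Icc (-1 : ℝ) 1, E) := ((0, x₀), cst x₀)
  have hu : F u = 0 := by simp [F, u]
  have hinr : fderiv ℝ F u ∘L .inr ℝ (ℝ × E) C(Icc (-1 : ℝ) 1, E) = ContinuousLinearMap.id ℝ _ := by
    have h1 : HasFDerivAt (fun γ : C(Icc (-1 : ℝ) 1, E) => F ((0, x₀), γ))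
        (fderiv ℝ F u ∘L .inr ℝ (ℝ × E) C(Icc (-1 : ℝ) 1, E)) (cst x₀) := by
      have := ((hF.differentiable hn') u).hasFDerivAt
      exact HasFDerivAt.comp (cst x₀) this (hasFDerivAt_prodMk_right (0, x₀) (cst x₀))
    have h2 : HasFDerivAt (fun γ : C(Icc (-1 : ℝ) 1, E) => F ((0, x₀), γ))
        (ContinuousLinearMap.id ℝ _) (cst x₀) := by
      have : (fun γ : C(Icc (-1 : ℝ) 1, E) => F ((0, x₀), γ)) = fun γ => γ - cst x₀ := by
        ext; simp [F]
      rw [this]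
      exact (hasFDerivAt_id _).sub_const _
    exact h1.unique h2
  have hinv : (fderiv ℝ F u ∘L .inr ℝ (ℝ × E) C(Icc (-1 : ℝ) 1, E)).IsInvertible := by
    rw [hinr]; exact ⟨ContinuousLinearEquiv.refl ℝ _, rfl⟩
  refine ⟨(hF.contDiffAt (x := u)).implicitFunction hn' hinv,
    (hF.contDiffAt (x := u)).contDiffAt_implicitFunction hn' hinv,
    (hF.contDiffAt (x := u)).implicitFunction_apply_self hn' hinv, ?_⟩
  filter_upwards [(hF.contDiffAt (x := u)).eventually_apply_implicitFunction hn' hinv] with z hz t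
  rw [hu] at hz
  have := congrArg (fun η : C(Icc (-1 : ℝ) 1, E) => η t) hz
  simp only [F, N, cst, ContinuousMap.sub_apply, ContinuousMap.smul_apply,
    ContinuousMap.zero_apply, ContinuousLinearMap.const_apply_apply] at this
  rw [sub_sub, sub_eq_zero] at this
  exact this

/-- A solution of the integral equation solves the differential equation. -/
theorem hasDerivAt_of_eq_curvePrimitive [CompleteSpace E] {v : E → E} (hv : Continuous v)
    {γ : C(Icc (-1 : ℝ) 1, E)}
    {s : ℝ} {x : E} (h : ∀ t, γ t = x + s • curvePrimitive E ((⟨v, hv⟩ : C(E, E)).comp γ) t) {t : ℝ}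
    (ht : t ∈ Ioo (-1 : ℝ) 1) :
    HasDerivAt (IccExtend (by norm_num : (-1 : ℝ) ≤ 1) γ)
      (s • v (IccExtend (by norm_num : (-1 : ℝ) ≤ 1) γ t)) t := by
  have hc : Continuous (fun r => v (IccExtend (by norm_num : (-1 : ℝ) ≤ 1) γ r)) :=
    hv.comp γ.continuous.Icc_extend'
  have h1 : HasDerivAt (fun t => x + s • ∫ r in (0 : ℝ)..t,
      v (IccExtend (by norm_num : (-1 : ℝ) ≤ 1) γ r))
      (s • v (IccExtend (by norm_num : (-1 : ℝ) ≤ 1) γ t)) t := by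
    refine HasDerivAt.const_add _ (HasDerivAt.const_smul s ?_)
    exact intervalIntegral.integral_hasDerivAt_right (hc.intervalIntegrable _ _)
      (hc.stronglyMeasurableAtFilter _ _) hc.continuousAt
  refine h1.congr_of_eventuallyEq ?_
  filter_upwards [Ioo_mem_nhds ht.1 ht.2] with r hr
  rw [IccExtend_of_mem _ _ ⟨hr.1.le, hr.2.le⟩, h]
  rfl

end LocalFlow

/-! ### The flow of a vector field on a compact manifold -/

section ManifoldFlow
open Set Filter

/-- A function of class `C^n` at a point coincides near this point with a globally `C^n`
function. -/
theorem ContDiffAt.exists_contDiff_eventuallyEq {E F : Type*} [NormedAddCommGroup E]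
    [NormedSpace ℝ E] [HasContDiffBump E] [NormedAddCommGroup F] [NormedSpace ℝ F] {n : ℕ}
    {f : E → F} {x : E} (hf : ContDiffAt ℝ n f x) :
    ∃ g : E → F, ContDiff ℝ n g ∧ g =ᶠ[𝓝 x] f := by
  obtain ⟨r, hr, hball⟩ := Metric.eventually_nhds_iff_ball.1
    (hf.eventually (by exact_mod_cast WithTop.coe_ne_top))
  let φ : ContDiffBump x := ⟨r / 4, r / 2, by positivity, by linarith⟩
  refine ⟨fun y => φ y • f y, contDiff_iff_contDiffAt.2 fun y => ?_, ?_⟩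
  · by_cases hy : y ∈ Metric.ball x r
    · exact φ.contDiffAt.smul (hball y hy)
    · have hy' : y ∉ tsupport φ := by
        rw [φ.tsupport_eq]
        intro h
        exact hy (Metric.closedBall_subset_ball (by simp only [φ]; linarith) h)
      refine (contDiffAt_const (c := (0 : F))).congr_of_eventuallyEq ?_
      filter_upwards [notMem_tsupport_iff_eventuallyEq.1 hy'] with z hz
      rw [hz, Pi.zero_apply, zero_smul]
  · filter_upwards [φ.eventuallyEq_one] with y hy
    rw [hy, Pi.one_apply, one_smul]

variable {n : ℕ} {M : Type*} [TopologicalSpace M] [ChartedSpace (EuclideanSpace ℝ (Fin n)) M]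
  [IsManifold (𝓡 n) ∞ M]

/-- A vector field read in the preferred chart at `x₀`. -/
noncomputable def vectorFieldInChart (X : ∀ x : M, TangentSpace (𝓡 n) x) (x₀ : M) :
    EuclideanSpace ℝ (Fin n) → EuclideanSpace ℝ (Fin n) := fun y =>
  tangentCoordChange (𝓡 n) ((extChartAt (𝓡 n) x₀).symm y) x₀ ((extChartAt (𝓡 n) x₀).symm y)
    (X ((extChartAt (𝓡 n) x₀).symm y))

theorem contDiffAt_vectorFieldInChart {X : ∀ x : M, TangentSpace (𝓡 n) x}
    (hX : ContMDiff (𝓡 n) (𝓡 n).tangent ∞ (fun x => (⟨x, X x⟩ : TangentBundle (𝓡 n) M))) (x₀ : M) :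
    ContDiffAt ℝ ∞ (vectorFieldInChart X x₀) (extChartAt (𝓡 n) x₀ x₀) := by
  have hv := (contMDiffAt_iff.1 (hX x₀)).2
  exact (hv.contDiffAt (range_mem_nhds_isInteriorPoint
    (BoundarylessManifold.isInteriorPoint (I := 𝓡 n)))).snd

/-- A curve in a chart whose velocity represents the tangent vector `u` has velocity `u` on the
manifold. -/
theorem hasMFDerivAt_extChartAt_symm_comp {x₀ : M} {f : ℝ → EuclideanSpace ℝ (Fin n)} {t : ℝ}
    (hmem : f t ∈ (extChartAt (𝓡 n) x₀).target)
    {u : TangentSpace (𝓡 n) ((extChartAt (𝓡 n) x₀).symm (f t))}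
    (h : HasDerivAt f (tangentCoordChange (𝓡 n) ((extChartAt (𝓡 n) x₀).symm (f t)) x₀
      ((extChartAt (𝓡 n) x₀).symm (f t)) u) t) :
    HasMFDerivAt 𝓘(ℝ, ℝ) (𝓡 n) ((extChartAt (𝓡 n) x₀).symm ∘ f) t
      ((1 : ℝ →L[ℝ] ℝ).smulRight u) := by
  let xₜ : M := (extChartAt (𝓡 n) x₀).symm (f t)
  have hft1 : xₜ ∈ (extChartAt (𝓡 n) x₀).source := (extChartAt (𝓡 n) x₀).map_target hmem
  have hft2 := mem_extChartAt_source (I := 𝓡 n) xₜ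
  let w : EuclideanSpace ℝ (Fin n) := u
  have hd : HasDerivAt ((extChartAt (𝓡 n) xₜ ∘ (extChartAt (𝓡 n) x₀).symm) ∘ f) w t := by
    rw [← tangentCoordChange_self (I := 𝓡 n) (x := xₜ) (z := xₜ) (v := w) hft2,
      ← tangentCoordChange_comp (x := x₀) ⟨⟨hft2, hft1⟩, hft2⟩]
    apply HasFDerivAt.comp_hasDerivAt _ _ h
    have key := hasFDerivWithinAt_tangentCoordChange (I := 𝓡 n) ⟨hft1, hft2⟩
    rw [(extChartAt (𝓡 n) x₀).right_inv hmem] at key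
    exact key.hasFDerivAt (by simp)
  have hfd : HasFDerivAt ((extChartAt (𝓡 n) xₜ ∘ (extChartAt (𝓡 n) x₀).symm) ∘ f)
      ((1 : ℝ →L[ℝ] ℝ).smulRight w) t := by
    rw [ContinuousLinearMap.smulRight_one_eq_toSpanSingleton]
    exact hd.hasFDerivAt
  refine ⟨(continuousAt_extChartAt_symm'' hmem).comp h.continuousAt, ?_⟩
  simp only [mfld_simps]
  exact hfd.hasFDerivWithinAt (s := univ)

/-- Near `x₀`, the integral curves of the multiples `s • X` with `s` small exist on `(-1, 1)`, and
they depend on `s` and on the starting point in a `C^k` manner. -/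
theorem exists_contDiffAt_integralCurve {X : ∀ x : M, TangentSpace (𝓡 n) x}
    (hX : ContMDiff (𝓡 n) (𝓡 n).tangent ∞ (fun x => (⟨x, X x⟩ : TangentBundle (𝓡 n) M)))
    {k : ℕ} (hk : k ≠ 0) (x₀ : M) :
    ∃ Γ : ℝ × EuclideanSpace ℝ (Fin n) → C(Icc (-1 : ℝ) 1, EuclideanSpace ℝ (Fin n)),
      ContDiffAt ℝ k Γ (0, extChartAt (𝓡 n) x₀ x₀) ∧
      Γ (0, extChartAt (𝓡 n) x₀ x₀) = ContinuousMap.const _ (extChartAt (𝓡 n) x₀ x₀) ∧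
      ∀ᶠ z in 𝓝 ((0 : ℝ), extChartAt (𝓡 n) x₀ x₀),
        Γ z ⟨0, by norm_num⟩ = z.2 ∧
        IsMIntegralCurveOn (I := 𝓡 n) (fun t => (extChartAt (𝓡 n) x₀).symm
          (IccExtend (by norm_num : (-1 : ℝ) ≤ 1) (Γ z) t)) (z.1 • X) (Ioo (-1) 1) := by
  set y₀ := extChartAt (𝓡 n) x₀ x₀ with hy₀
  obtain ⟨w, hw, hwX⟩ := ((contDiffAt_vectorFieldInChart hX x₀).of_le
    (show (k : WithTop ℕ∞) ≤ ∞ by exact_mod_cast le_top)).exists_contDiff_eventuallyEq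
  obtain ⟨Γ, hΓ, hΓ0, hΓs⟩ := exists_contDiffAt_solution hk hw y₀
  refine ⟨Γ, hΓ, hΓ0, ?_⟩
  obtain ⟨r, hr, hball⟩ := Metric.eventually_nhds_iff_ball.1
    (hwX.and (extChartAt_target_mem_nhds (I := 𝓡 n) x₀))
  have hnear : ∀ᶠ z in 𝓝 ((0 : ℝ), y₀), dist (Γ z) (Γ (0, y₀)) < r :=
    (Metric.tendsto_nhds (α := C(Icc (-1 : ℝ) 1, EuclideanSpace ℝ (Fin n)))).1 hΓ.continuousAt r hr
  filter_upwards [hΓs, hnear] with z hz hzr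
  have hmem : ∀ t, Γ z t ∈ Metric.ball y₀ r := fun t => by
    have := (ContinuousMap.dist_apply_le_dist (f := Γ z) (g := Γ (0, y₀)) t).trans_lt hzr
    rwa [hΓ0] at this
  refine ⟨?_, fun t ht => ?_⟩
  · rw [hz, curvePrimitive_apply]
    simp
  · have hd := hasDerivAt_of_eq_curvePrimitive hw.continuous hz ht
    have hm : IccExtend (by norm_num : (-1 : ℝ) ≤ 1) (Γ z) t ∈ Metric.ball y₀ r := hmem _
    refine (hasMFDerivAt_extChartAt_symm_comp (hball _ hm).2 ?_).hasMFDerivWithinAt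
    rw [(hball _ hm).1] at hd
    refine hd.congr_deriv ?_
    exact (map_smul (tangentCoordChange (𝓡 n) _ x₀ _) z.1 _).symm

variable [T2Space M] [CompactSpace M]

/-- On a compact manifold, smooth vector fields are complete. -/
theorem exists_isMIntegralCurve_of_compactSpace {X : ∀ x : M, TangentSpace (𝓡 n) x}
    (hX : ContMDiff (𝓡 n) (𝓡 n).tangent ∞ (fun x => (⟨x, X x⟩ : TangentBundle (𝓡 n) M))) (x : M) :
    ∃ γ : ℝ → M, γ 0 = x ∧ IsMIntegralCurve (I := 𝓡 n) γ X := by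
  have hloc : ∀ x₀ ∈ (univ : Set M), ∀ᶠ z : ℝ × M in 𝓝 (0, x₀), ∃ γ : ℝ → M, γ 0 = z.2 ∧
      IsMIntegralCurveOn (I := 𝓡 n) γ (z.1 • X) (Ioo (-1) 1) := by
    intro x₀ _
    obtain ⟨Γ, -, -, hΓ⟩ := exists_contDiffAt_integralCurve hX one_ne_zero x₀
    have hc : ContinuousAt (fun z : ℝ × M => (z.1, extChartAt (𝓡 n) x₀ z.2)) (0, x₀) :=
      continuousAt_fst.prodMk ((continuousAt_extChartAt x₀).comp (x := ((0 : ℝ), x₀)) continuousAt_snd)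
    have hsrc : ∀ᶠ z : ℝ × M in 𝓝 (0, x₀), z.2 ∈ (extChartAt (𝓡 n) x₀).source :=
      continuousAt_snd.eventually (extChartAt_source_mem_nhds x₀)
    filter_upwards [hc.eventually hΓ, hsrc] with z hz hzs
    refine ⟨_, ?_, hz.2⟩
    rw [IccExtend_of_mem _ _ (by norm_num), hz.1]
    exact (extChartAt (𝓡 n) x₀).left_inv hzs
  obtain ⟨ε, hε, hball⟩ := Metric.eventually_nhds_iff_ball.1
    (isCompact_univ.eventually_forall_of_forall_eventually (P := fun s x => ∃ γ : ℝ → M, γ 0 = x ∧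
      IsMIntegralCurveOn (I := 𝓡 n) γ (s • X) (Ioo (-1) 1)) hloc)
  refine exists_isMIntegralCurve_of_isMIntegralCurveOn (hX.of_le (by exact_mod_cast le_top))
    (half_pos hε) (fun x => ?_) x
  obtain ⟨γ, hγ0, hγ⟩ := hball (ε / 2) (by simp [abs_of_pos hε, half_lt_self hε]) x (mem_univ x)
  refine ⟨γ ∘ (· * (ε / 2)⁻¹), by simp [hγ0], ?_⟩
  have := hγ.comp_mul (ε / 2)⁻¹
  rw [smul_smul, inv_mul_cancel₀ (half_pos hε).ne', one_smul] at this
  refine this.mono fun t ht => ?_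
  change t * (ε / 2)⁻¹ ∈ Ioo (-1 : ℝ) 1
  rw [← div_eq_mul_inv]
  constructor
  · rw [lt_div_iff₀ (half_pos hε)]; linarith [ht.1]
  · rw [div_lt_iff₀ (half_pos hε)]; linarith [ht.2]

/-- The position at time `z.1` of the orbit of `X` that starts at `z.2`. -/
noncomputable def flowMap {X : ∀ x : M, TangentSpace (𝓡 n) x}
    (hX : ContMDiff (𝓡 n) (𝓡 n).tangent ∞ (fun x => (⟨x, X x⟩ : TangentBundle (𝓡 n) M)))
    (z : ℝ × M) : M :=
  (exists_isMIntegralCurve_of_compactSpace hX z.2).choose z.1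

variable {X : ∀ x : M, TangentSpace (𝓡 n) x}
  (hX : ContMDiff (𝓡 n) (𝓡 n).tangent ∞ (fun x => (⟨x, X x⟩ : TangentBundle (𝓡 n) M)))

theorem flowMap_zero (x : M) : flowMap hX (0, x) = x :=
  (exists_isMIntegralCurve_of_compactSpace hX x).choose_spec.1

theorem isMIntegralCurve_flowMap (x : M) :
    IsMIntegralCurve (I := 𝓡 n) (fun t => flowMap hX (t, x)) X :=
  (exists_isMIntegralCurve_of_compactSpace hX x).choose_spec.2

theorem eq_flowMap_of_isMIntegralCurve {γ : ℝ → M} (hγ : IsMIntegralCurve (I := 𝓡 n) γ X) (t : ℝ) :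
    γ t = flowMap hX (t, γ 0) := by
  have := isMIntegralCurve_Ioo_eq_of_contMDiff_boundaryless (t₀ := 0)
    (hX.of_le (by exact_mod_cast le_top)) hγ (isMIntegralCurve_flowMap hX (γ 0))
    (flowMap_zero hX (γ 0)).symm
  exact congrFun this t

theorem flowMap_add (s t : ℝ) (x : M) : flowMap hX (s + t, x) = flowMap hX (s, flowMap hX (t, x)) := by
  have h := (isMIntegralCurve_flowMap hX x).comp_add t
  have := eq_flowMap_of_isMIntegralCurve hX h s
  simpa using this

/-- Near time `0`, the flow is of class `C^k` for each finite `k`. -/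
theorem contMDiffAt_flowMap_zero {k : ℕ} (hk : k ≠ 0) (x₀ : M) :
    ContMDiffAt (𝓘(ℝ, ℝ).prod (𝓡 n)) (𝓡 n) k (flowMap hX) (0, x₀) := by
  obtain ⟨Γ, hΓs, hΓ0, hΓ⟩ := exists_contDiffAt_integralCurve hX hk x₀
  have hchart : ContMDiffAt (𝓘(ℝ, ℝ).prod (𝓡 n)) 𝓘(ℝ, ℝ × EuclideanSpace ℝ (Fin n)) k
      (fun z : ℝ × M => (2 * z.1, extChartAt (𝓡 n) x₀ z.2)) (0, x₀) := by
    refine ContMDiffAt.prodMk_space ?_ ?_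
    · exact contMDiffAt_const.mul contMDiffAt_fst
    · exact ContMDiffAt.comp ((0 : ℝ), x₀) contMDiffAt_extChartAt contMDiffAt_snd
  have hsrc : ∀ᶠ z : ℝ × M in 𝓝 (0, x₀), z.2 ∈ (extChartAt (𝓡 n) x₀).source :=
    continuousAt_snd.eventually (extChartAt_source_mem_nhds x₀)
  have h2 : ((2 : ℝ) * 0, extChartAt (𝓡 n) x₀ x₀) = (0, extChartAt (𝓡 n) x₀ x₀) := by simp
  let ev := ContinuousMap.evalCLM (M := EuclideanSpace ℝ (Fin n)) ℝ
    (⟨1 / 2, by norm_num⟩ : Icc (-1 : ℝ) 1)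
  have hev : ContMDiffAt (𝓘(ℝ, ℝ).prod (𝓡 n)) 𝓘(ℝ, EuclideanSpace ℝ (Fin n)) k
      (fun z : ℝ × M => ev (Γ (2 * z.1, extChartAt (𝓡 n) x₀ z.2))) (0, x₀) := by
    have h3 : ContDiffAt ℝ k (fun w => ev (Γ w)) (2 * 0, extChartAt (𝓡 n) x₀ x₀) := by
      rw [h2]; exact ev.contDiff.contDiffAt.comp _ hΓs
    exact ContMDiffAt.comp (g := fun w => ev (Γ w)) ((0 : ℝ), x₀) h3.contMDiffAt hchart
  have hfin : ContMDiffAt (𝓘(ℝ, ℝ).prod (𝓡 n)) (𝓡 n) k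
      (fun z : ℝ × M => (extChartAt (𝓡 n) x₀).symm
        (ev (Γ (2 * z.1, extChartAt (𝓡 n) x₀ z.2)))) (0, x₀) := by
    refine ContMDiffAt.comp ((0 : ℝ), x₀) ?_ hev
    have : ev (Γ (2 * 0, extChartAt (𝓡 n) x₀ x₀)) = extChartAt (𝓡 n) x₀ x₀ := by
      rw [h2, hΓ0]; rfl
    rw [this]
    exact (contMDiffOn_extChartAt_symm x₀).contMDiffAt (extChartAt_target_mem_nhds x₀)
  refine hfin.congr_of_eventuallyEq ?_
  have hc := hchart.continuousAt
  rw [ContinuousAt, h2] at hc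
  filter_upwards [hc.eventually hΓ, hsrc] with z hz hzs
  have hXs : ContMDiff (𝓡 n) (𝓡 n).tangent 1
      (fun x => (⟨x, ((2 * z.1) • X) x⟩ : TangentBundle (𝓡 n) M)) :=
    ContMDiff.const_smul_section (hX.of_le (by exact_mod_cast le_top))
  have := isMIntegralCurveOn_Ioo_eqOn_of_contMDiff_boundaryless (t₀ := 0) (by norm_num) hXs hz.2
    (((isMIntegralCurve_flowMap hX z.2).comp_mul (2 * z.1)).isMIntegralCurveOn (Ioo (-1) 1)) ?_
    (show (1 / 2 : ℝ) ∈ Ioo (-1 : ℝ) 1 by norm_num)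
  · simp only [Function.comp_apply] at this
    rw [IccExtend_of_mem _ _ (by norm_num), show (1 / 2 * (2 * z.1) : ℝ) = z.1 by ring] at this
    exact this.symm
  · rw [IccExtend_of_mem _ _ (by norm_num), hz.1]
    simp only [Function.comp_apply, zero_mul, flowMap_zero]
    exact (extChartAt (𝓡 n) x₀).left_inv hzs

/-- The flow of a smooth vector field on a compact manifold is smooth in time and space. -/
theorem contMDiff_flowMap :
    ContMDiff (𝓘(ℝ, ℝ).prod (𝓡 n)) (𝓡 n) ∞ (flowMap hX) := by
  suffices h : ∀ k : ℕ, k ≠ 0 → ContMDiff (𝓘(ℝ, ℝ).prod (𝓡 n)) (𝓡 n) k (flowMap hX) by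
    refine contMDiff_infty.2 fun k => ?_
    exact (h (k + 1) k.succ_ne_zero).of_le (by exact_mod_cast Nat.le_succ k)
  intro k hk
  have : IsManifold (𝓡 n) k M := IsManifold.of_le (n := ∞) (by exact_mod_cast le_top)
  obtain ⟨ε, hε, hball⟩ := Metric.eventually_nhds_iff_ball.1
    (isCompact_univ.eventually_forall_of_forall_eventually (x₀ := (0 : ℝ)) (K := (univ : Set M))
      (P := fun s x => ContMDiffAt (𝓘(ℝ, ℝ).prod (𝓡 n)) (𝓡 n) k (flowMap hX) (s, x))
      fun x₀ _ => (contMDiffAt_iff_contMDiffAt_nhds (by exact_mod_cast WithTop.coe_ne_top)).1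
        (contMDiffAt_flowMap_zero hX hk x₀))
  -- the range of times is enlarged by doubling
  have hdouble : ∀ (m : ℕ) (t : ℝ) (x : M), |t| < 2 ^ m * ε →
      ContMDiffAt (𝓘(ℝ, ℝ).prod (𝓡 n)) (𝓡 n) k (flowMap hX) (t, x) := by
    intro m
    induction m with
    | zero =>
      intro t x ht
      exact hball t (by simpa using ht) x (mem_univ x)
    | succ m ih =>
      intro t x ht
      have ht2 : |t / 2| < 2 ^ m * ε := by
        rw [abs_div, abs_two, div_lt_iff₀ two_pos]; rw [pow_succ] at ht; linarith
      have heq : flowMap hX = fun z : ℝ × M => flowMap hX (z.1 / 2, flowMap hX (z.1 / 2, z.2)) := by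
        funext z
        rw [← flowMap_add, add_halves]
      have hhalf : ContMDiffAt (𝓘(ℝ, ℝ).prod (𝓡 n)) 𝓘(ℝ, ℝ) k (fun z : ℝ × M => z.1 / 2) (t, x) := by
        simp only [div_eq_mul_inv]
        exact contMDiffAt_fst.mul contMDiffAt_const
      rw [heq]
      refine ContMDiffAt.comp (t, x) (ih _ _ ht2) (hhalf.prodMk ?_)
      exact ContMDiffAt.comp (t, x) (ih _ _ ht2) (hhalf.prodMk contMDiffAt_snd)
  rintro ⟨t, x⟩
  obtain ⟨m, hm⟩ := pow_unbounded_of_one_lt (|t| / ε) one_lt_two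
  exact hdouble m t x ((div_lt_iff₀ hε).1 hm)

/-- The flow of a smooth vector field on a compact manifold, as a topological flow. -/
noncomputable def flowOfVectorField : Flow ℝ M where
  toFun t x := flowMap hX (t, x)
  cont' := (contMDiff_flowMap hX).continuous
  map_add' s t x := flowMap_add hX s t x
  map_zero' x := flowMap_zero hX x

end ManifoldFlow

/-! ### Averages along the flow -/

section FlowAverages
open Set Filter

variable {n : ℕ} {M : Type*} [TopologicalSpace M] [ChartedSpace (EuclideanSpace ℝ (Fin n)) M]
  [IsManifold (𝓡 n) ∞ M]

/-- Integrals over `[0, 1]` of a `C^k` function on a Euclidean space depend on the remaining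
variables in a `C^k` manner. -/
theorem ContDiff.intervalIntegral_prodMk {E : Type} [NormedAddCommGroup E] [NormedSpace ℝ E] {k : ℕ}
    {F : ℝ × E → ℝ} (hF : ContDiff ℝ k F) : ContDiff ℝ k (fun y => ∫ r in (0 : ℝ)..1, F (r, y)) := by
  let c₀ : C(Icc (-1 : ℝ) 1, ℝ × E) := ⟨fun t => (t, 0), by fun_prop⟩
  let L : E →L[ℝ] C(Icc (-1 : ℝ) 1, ℝ × E) :=
    (ContinuousLinearMap.const ℝ _).comp (ContinuousLinearMap.inr ℝ ℝ E)
  let ev := ContinuousMap.evalCLM (M := ℝ) ℝ (⟨1, by norm_num⟩ : Icc (-1 : ℝ) 1)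
  have h : (fun y => ∫ r in (0 : ℝ)..1, F (r, y)) = fun y =>
      ev (curvePrimitive ℝ ((⟨F, hF.continuous⟩ : C(ℝ × E, ℝ)).comp (c₀ + L y))) := by
    funext y
    refine intervalIntegral.integral_congr fun r hr => ?_
    rw [uIcc_of_le zero_le_one] at hr
    rw [IccExtend_of_mem _ _ (⟨by linarith [hr.1], hr.2⟩ : r ∈ Icc (-1 : ℝ) 1)]
    simp [c₀, L]
  rw [h]
  exact (ev.contDiff.comp (curvePrimitive ℝ).contDiff).comp
    ((hF.continuousMap_comp_left k hF.continuous).comp (contDiff_const.add L.contDiff))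

/-- Integrals of a smooth function over a parameter in `[0, 1]` are smooth. -/
theorem ContMDiff.intervalIntegral_prodMk {F : ℝ × M → ℝ}
    (hF : ContMDiff (𝓘(ℝ, ℝ).prod (𝓡 n)) 𝓘(ℝ, ℝ) ∞ F) :
    ContMDiff (𝓡 n) 𝓘(ℝ, ℝ) ∞ (fun x => ∫ r in (0 : ℝ)..1, F (r, x)) := by
  refine contMDiff_infty.2 fun k x₀ => ?_
  obtain ⟨r, hr, hball⟩ := Metric.eventually_nhds_iff_ball.1
    (eventually_mem_nhds_iff.2 (extChartAt_target_mem_nhds (I := 𝓡 n) x₀))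
  let χ : ContDiffBump (extChartAt (𝓡 n) x₀ x₀) := ⟨r / 4, r / 2, by positivity, by linarith⟩
  let Φ : ℝ × EuclideanSpace ℝ (Fin n) → ℝ := fun z =>
    χ z.2 * F (z.1, (extChartAt (𝓡 n) x₀).symm z.2)
  have hΦ : ContDiff ℝ k Φ := by
    refine contDiff_iff_contDiffAt.2 fun z => ?_
    by_cases hz : z.2 ∈ Metric.ball (extChartAt (𝓡 n) x₀ x₀) r
    · have h1 : ContMDiffAt 𝓘(ℝ, ℝ × EuclideanSpace ℝ (Fin n)) (𝓘(ℝ, ℝ).prod (𝓡 n)) ∞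
          (fun z : ℝ × EuclideanSpace ℝ (Fin n) => (z.1, (extChartAt (𝓡 n) x₀).symm z.2)) z := by
        refine ContMDiffAt.prodMk contDiff_fst.contMDiff.contMDiffAt ?_
        exact ContMDiffAt.comp z ((contMDiffOn_extChartAt_symm x₀).contMDiffAt (hball _ hz))
          contDiff_snd.contMDiff.contMDiffAt
      have h2 : ContDiffAt ℝ ∞ (fun z : ℝ × EuclideanSpace ℝ (Fin n) =>
          F (z.1, (extChartAt (𝓡 n) x₀).symm z.2)) z :=
        (ContMDiffAt.comp z (hF _) h1).contDiffAt
      exact (χ.contDiffAt.comp z contDiffAt_snd).mul (h2.of_le (by exact_mod_cast le_top))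
    · have hy' : z.2 ∉ tsupport χ := by
        rw [χ.tsupport_eq]
        intro h
        exact hz (Metric.closedBall_subset_ball (by simp only [χ]; linarith) h)
      refine (contDiffAt_const (c := (0 : ℝ))).congr_of_eventuallyEq ?_
      filter_upwards [continuousAt_snd.eventually (notMem_tsupport_iff_eventuallyEq.1 hy')] with w hw
      simp only [Φ]
      rw [hw, Pi.zero_apply, zero_mul]
  have hcomp : ContMDiffAt (𝓡 n) 𝓘(ℝ, ℝ) k
      (fun x => (fun y => ∫ r in (0 : ℝ)..1, Φ (r, y)) (extChartAt (𝓡 n) x₀ x)) x₀ :=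
    ContMDiffAt.comp x₀ (g := fun y => ∫ r in (0 : ℝ)..1, Φ (r, y))
      hΦ.intervalIntegral_prodMk.contMDiff.contMDiffAt
      (contMDiffAt_extChartAt.of_le (n := ∞) (by exact_mod_cast le_top))
  refine hcomp.congr_of_eventuallyEq ?_
  filter_upwards [(continuousAt_extChartAt (I := 𝓡 n) x₀).eventually χ.eventuallyEq_one,
    extChartAt_source_mem_nhds (I := 𝓡 n) x₀] with x hx hxs
  simp only [Φ, (extChartAt (𝓡 n) x₀).left_inv hxs]
  rw [hx]
  simp only [Pi.one_apply, one_mul]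

omit [IsManifold (𝓡 n) ∞ M] in
/-- The derivative of a function along an orbit of `X`. -/
theorem IsMIntegralCurve.hasDerivAt_comp {X : ∀ x : M, TangentSpace (𝓡 n) x} {γ : ℝ → M}
    (hγ : IsMIntegralCurve (I := 𝓡 n) γ X) {g : M → ℝ} {t : ℝ}
    (hg : MDifferentiableAt (𝓡 n) 𝓘(ℝ, ℝ) g (γ t)) :
    HasDerivAt (fun s => g (γ s)) (vectorDeriv X g (γ t)) t := by
  have h := HasMFDerivAt.comp t hg.hasMFDerivAt (hγ t)
  let A : EuclideanSpace ℝ (Fin n) →L[ℝ] ℝ := mfderiv (𝓡 n) 𝓘(ℝ, ℝ) g (γ t)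
  let w : EuclideanSpace ℝ (Fin n) := X (γ t)
  have h2 : HasFDerivAt (fun s => g (γ s)) (A.comp ((1 : ℝ →L[ℝ] ℝ).smulRight w)) t :=
    h.hasFDerivAt
  have h3 := h2.hasDerivAt
  simp only [ContinuousLinearMap.comp_apply, ContinuousLinearMap.smulRight_apply,
    one_apply_eq_self, one_smul] at h3
  exact h3

variable [T2Space M] [CompactSpace M] {X : ∀ x : M, TangentSpace (𝓡 n) x}
  (hX : ContMDiff (𝓡 n) (𝓡 n).tangent ∞ (fun x => (⟨x, X x⟩ : TangentBundle (𝓡 n) M)))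

/-- If the flow at one time `T > 0` does not increase `h`, the average of `h` along orbit segments
of length `T` is not increased by the flow at any positive time. -/
theorem exists_vectorDeriv_nonpos_of_flow {h : M → ℝ} (hh : ContMDiff (𝓡 n) 𝓘(ℝ, ℝ) ∞ h) {T : ℝ}
    (hT : 0 < T) (hle : ∀ x, h (flowMap hX (T, x)) ≤ h x) :
    ∃ g : M → ℝ, ContMDiff (𝓡 n) 𝓘(ℝ, ℝ) ∞ g ∧ (∀ x, vectorDeriv X g x ≤ 0) ∧
      ∀ p c, (∀ t, flowMap hX (t, p) = p) → (∀ᶠ x in 𝓝 p, h x = c) → ∀ᶠ x in 𝓝 p, g x = c := by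
  have hmap : ContMDiff (𝓘(ℝ, ℝ).prod (𝓡 n)) 𝓘(ℝ, ℝ) ∞
      (fun z : ℝ × M => h (flowMap hX (T * z.1, z.2))) :=
    hh.comp ((contMDiff_flowMap hX).comp ((contMDiff_const.mul contMDiff_fst).prodMk contMDiff_snd))
  have hg := hmap.intervalIntegral_prodMk
  refine ⟨_, hg, fun x => ?_, fun p c hp hpc => ?_⟩
  · have hcont : Continuous (fun s => h (flowMap hX (s, x))) :=
      hh.continuous.comp ((contMDiff_flowMap hX).continuous.comp (by fun_prop))
    have h1 := (isMIntegralCurve_flowMap hX x).hasDerivAt_comp (t := 0)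
      (hg.mdifferentiable (by simp) _)
    rw [flowMap_zero] at h1
    have h2 : HasDerivAt (fun t => T⁻¹ * ((∫ s in (0 : ℝ)..T + t, h (flowMap hX (s, x)))
        - ∫ s in (0 : ℝ)..t, h (flowMap hX (s, x))))
        (T⁻¹ * (h (flowMap hX (T, x)) - h x)) 0 := by
      have hprim (b : ℝ) : HasDerivAt (fun t => ∫ s in (0 : ℝ)..t, h (flowMap hX (s, x)))
          (h (flowMap hX (b, x))) b :=
        intervalIntegral.integral_hasDerivAt_right (hcont.intervalIntegrable _ _)
          (hcont.stronglyMeasurableAtFilter _ _) hcont.continuousAt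
      have ha := HasDerivAt.comp_const_add T 0 (hprim (T + 0))
      have hb := hprim 0
      rw [flowMap_zero] at hb
      rw [add_zero] at ha
      exact (ha.sub hb).const_mul _
    have h3 : vectorDeriv X (fun x => ∫ r in (0 : ℝ)..1, h (flowMap hX (T * r, x))) x =
        T⁻¹ * (h (flowMap hX (T, x)) - h x) := by
      refine h1.unique (h2.congr_of_eventuallyEq (Eventually.of_forall fun t => ?_))
      simp only [← flowMap_add]
      rw [intervalIntegral.integral_interval_sub_left (hcont.intervalIntegrable _ _)
        (hcont.intervalIntegrable _ _),
        intervalIntegral.integral_comp_mul_add (fun s => h (flowMap hX (s, x))) hT.ne' t]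
      simp
    rw [h3]
    exact mul_nonpos_of_nonneg_of_nonpos (by positivity) (sub_nonpos.2 (hle x))
  · have hev : ∀ᶠ x in 𝓝 p, ∀ r ∈ Icc (0 : ℝ) 1, h (flowMap hX (T * r, x)) = c := by
      refine isCompact_Icc.eventually_forall_of_forall_eventually
        (P := fun x r => h (flowMap hX (T * r, x)) = c) fun r _ => ?_
      have hc : ContinuousAt (fun z : M × ℝ => flowMap hX (T * z.2, z.1)) (p, r) :=
        ((contMDiff_flowMap hX).continuous.comp (by fun_prop)).continuousAt
      rw [ContinuousAt, hp] at hc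
      exact hc.eventually hpc
    filter_upwards [hev] with x hx
    rw [intervalIntegral.integral_congr (g := fun _ => c) fun r hr => ?_]
    · simp
    · rw [uIcc_of_le zero_le_one] at hr
      exact hx r hr

end FlowAverages

/-! ### Gradient-like flows on compact spaces -/

section GradientLikeFlow
open Set Filter

variable {α : Type*} [TopologicalSpace α]

/-- A flow is gradient-like for `f` and the finite set `S` if the points of `S` are at rest and `f`
decreases strictly along all the other orbits. -/
structure IsGradientLike (φ : Flow ℝ α) (f : α → ℝ) (S : Set α) : Prop where
  continuous : Continuous f
  finite : S.Finite
  fixed : ∀ p ∈ S, ∀ t, φ t p = p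
  lt : ∀ x, x ∉ S → ∀ t, 0 < t → f (φ t x) < f x

namespace IsGradientLike

variable {φ : Flow ℝ α} {f : α → ℝ} {S : Set α}

theorem reverse (h : IsGradientLike φ f S) : IsGradientLike φ.reverse (fun x => -f x) S where
  continuous := h.continuous.neg
  finite := h.finite
  fixed p hp t := h.fixed p hp (-t)
  lt x hx t ht := by
    have hx' : φ (-t) x ∉ S := fun hm => hx (by
      have := h.fixed _ hm t
      rw [← φ.map_add, add_neg_cancel, φ.map_zero_apply] at this
      rwa [this])
    have := h.lt _ hx' t ht
    rw [← φ.map_add, add_neg_cancel, φ.map_zero_apply] at this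
    exact neg_lt_neg this

theorem le (h : IsGradientLike φ f S) (x : α) {t : ℝ} (ht : 0 ≤ t) : f (φ t x) ≤ f x := by
  by_cases hx : x ∈ S
  · rw [h.fixed x hx]
  · rcases ht.eq_or_lt with rfl | ht
    · rw [φ.map_zero_apply]
    · exact (h.lt x hx t ht).le

theorem antitone (h : IsGradientLike φ f S) (x : α) : Antitone fun t => f (φ t x) := fun s t hst => by
  have := h.le (φ s x) (sub_nonneg.2 hst)
  rwa [← φ.map_add, sub_add_cancel] at this

theorem lt_of_tendsto (h : IsGradientLike φ f S) {x p q : α} (hx : x ∉ S)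
    (hp : Tendsto (fun t => φ t x) atBot (𝓝 p)) (hq : Tendsto (fun t => φ t x) atTop (𝓝 q)) :
    f q < f p := by
  have h1 : f q ≤ f x := by
    refine le_of_tendsto ((h.continuous.tendsto q).comp hq) ?_
    filter_upwards [eventually_ge_atTop 0] with t ht using h.le x ht
  have h2 : f (φ (-1) x) ≤ f p := by
    refine ge_of_tendsto ((h.continuous.tendsto p).comp hp) ?_
    filter_upwards [eventually_le_atBot (-1)] with t ht using h.antitone x ht
  have h3 : f x < f (φ (-1) x) := by
    have := h.reverse.lt x hx 1 one_pos
    simpa [Flow.reverse_apply] using this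
  linarith

variable [CompactSpace α]

/-- The limit points of an orbit are at rest. -/
theorem mem_of_mapClusterPt (h : IsGradientLike φ f S) {x y : α}
    (hy : MapClusterPt y atTop fun t => φ t x) : y ∈ S := by
  have hbdd : BddBelow (range fun t => f (φ t x)) :=
    (isCompact_range h.continuous).bddBelow.mono (range_subset_iff.2 fun t => mem_range_self _)
  have hlim := tendsto_atTop_ciInf (h.antitone x) hbdd
  set L := ⨅ t, f (φ t x)
  have hval : ∀ s, f (φ s y) = L := by
    intro s
    have h1 : MapClusterPt (f (φ s y)) atTop ((fun z => f (φ s z)) ∘ fun t => φ t x) :=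
      hy.continuousAt_comp (f := fun z => f (φ s z))
        (h.continuous.comp (φ.continuous continuous_const continuous_id)).continuousAt
    have h2 : Tendsto ((fun z => f (φ s z)) ∘ fun t => φ t x) atTop (𝓝 L) := by
      have : ((fun z => f (φ s z)) ∘ fun t => φ t x) = fun t => f (φ (s + t) x) := by
        funext t; simp [φ.map_add]
      rw [this]
      exact hlim.comp (tendsto_atTop_add_const_left _ s tendsto_id)
    have h3 : ClusterPt (f (φ s y)) (𝓝 L) := ClusterPt.mono h1 h2
    exact eq_of_nhds_neBot h3
  by_contra hyS
  have := h.lt y hyS 1 one_pos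
  rw [hval 1, ← hval 0, φ.map_zero_apply] at this
  exact lt_irrefl _ this

variable [T2Space α]

/-- Every orbit converges to a point at rest: its limit points form a connected subset of a finite
set. -/
theorem exists_tendsto_atTop (h : IsGradientLike φ f S) (x : α) :
    ∃ p ∈ S, Tendsto (fun t => φ t x) atTop (𝓝 p) := by
  obtain ⟨U, hU, hdisj⟩ := h.finite.t2_separation
  have hopen : IsOpen (⋃ p ∈ S, U p) := isOpen_biUnion fun p _ => (hU p).2
  have hev : ∀ᶠ t in atTop, φ t x ∈ ⋃ p ∈ S, U p := by
    by_contra hne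
    have hfreq : ∃ᶠ t in atTop, φ t x ∈ (⋃ p ∈ S, U p)ᶜ := not_eventually.1 hne
    obtain ⟨y, hyc, hy⟩ := hopen.isClosed_compl.isCompact.exists_mapClusterPt_of_frequently hfreq
    exact hyc (mem_biUnion (h.mem_of_mapClusterPt hy) (hU y).1)
  obtain ⟨T, hT⟩ := eventually_atTop.1 hev
  obtain ⟨p, hp, hpT⟩ := mem_iUnion₂.1 (hT T le_rfl)
  have hopen' : IsOpen (⋃ q ∈ S \ {p}, U q) := isOpen_biUnion fun q _ => (hU q).2
  have hstay : (fun t => φ t x) '' Ici T ⊆ U p := by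
    refine IsPreconnected.subset_left_of_subset_union (hU p).2 hopen' ?_ ?_ ⟨_, ⟨T, self_mem_Ici, rfl⟩, hpT⟩
      (isPreconnected_Ici.image _ (φ.continuous continuous_id continuous_const).continuousOn)
    · refine disjoint_iUnion₂_right.2 fun q hq => ?_
      exact hdisj hp hq.1 fun hpq => hq.2 hpq.symm
    · rintro _ ⟨t, ht, rfl⟩
      obtain ⟨q, hq, hqt⟩ := mem_iUnion₂.1 (hT t ht)
      by_cases hqp : q = p
      · exact Or.inl (hqp ▸ hqt)
      · exact Or.inr (mem_biUnion (show q ∈ S \ {p} from ⟨hq, hqp⟩) hqt)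
  refine ⟨p, hp, le_nhds_of_unique_clusterPt fun y hy => ?_⟩
  have hyS := h.mem_of_mapClusterPt hy
  by_contra hyp
  have hf := mapClusterPt_iff_frequently.1 hy (U y) ((hU y).2.mem_nhds (hU y).1)
  obtain ⟨t, hty, htT⟩ := (hf.and_eventually (eventually_ge_atTop T)).exists
  exact disjoint_left.1 (hdisj hyS hp hyp) hty (hstay ⟨t, htT, rfl⟩)

theorem exists_tendsto_atBot (h : IsGradientLike φ f S) (x : α) :
    ∃ p ∈ S, Tendsto (fun t => φ t x) atBot (𝓝 p) := by
  obtain ⟨p, hp, ht⟩ := h.reverse.exists_tendsto_atTop x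
  refine ⟨p, hp, ?_⟩
  have := ht.comp tendsto_neg_atBot_atTop
  simpa [Function.comp_def, Flow.reverse_apply] using this

end IsGradientLike

/-- The prolongation relation of a flow: the closure of the relation "`y` lies on the forward orbit
of `x`". -/
def Flow.prolongation (φ : Flow ℝ α) : Set (α × α) :=
  closure {z | ∃ t, 0 ≤ t ∧ z.2 = φ t z.1}

/-- If a rest point `q` is in the prolongation of `y`, it is in that of the points of the forward
orbit of `y`. -/
theorem Flow.map_mem_prolongation {φ : Flow ℝ α} {y q : α} (hq : ∀ t, φ t q = q)
    (h : (y, q) ∈ φ.prolongation) {t : ℝ} (ht : 0 ≤ t) : (φ t y, q) ∈ φ.prolongation := by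
  refine mem_closure_iff_nhds.2 fun N hN => ?_
  obtain ⟨U, hU, W, hW, hUW⟩ := mem_nhds_prod_iff.1 hN
  have hA : ∀ᶠ u in 𝓝 y, φ t u ∈ U :=
    (φ.continuous continuous_const continuous_id).continuousAt.eventually hU
  have hB : ∀ᶠ w in 𝓝 q, ∀ s ∈ Icc 0 t, φ s w ∈ W := by
    refine isCompact_Icc.eventually_forall_of_forall_eventually (P := fun w s => φ s w ∈ W)
      fun s _ => ?_
    have hc : ContinuousAt (fun z : α × ℝ => φ z.2 z.1) (q, s) :=
      (φ.continuous continuous_snd continuous_fst).continuousAt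
    rw [ContinuousAt, hq] at hc
    exact hc.eventually hW
  obtain ⟨⟨u, w⟩, ⟨hu, hw⟩, s, hs, hsw⟩ := mem_closure_iff_nhds.1 h _ (prod_mem_nhds hA hB)
  simp only [mem_ofPred_eq] at hu hw hsw
  subst hsw
  rcases le_total t s with hts | hst
  · refine ⟨(φ t u, φ s u), hUW ⟨hu, ?_⟩, s - t, sub_nonneg.2 hts, ?_⟩
    · simpa [φ.map_zero_apply] using hw 0 ⟨le_rfl, ht⟩
    · rw [← φ.map_add, sub_add_cancel]
  · refine ⟨(φ t u, φ t u), hUW ⟨hu, ?_⟩, 0, le_rfl, (φ.map_zero_apply _).symm⟩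
    have := hw (t - s) ⟨sub_nonneg.2 hst, by linarith⟩
    rwa [← φ.map_add, sub_add_cancel] at this

variable [CompactSpace α]

/-- Orbits that start close to the rest point `p` and come close to a point `q` away from `p` leave
every small neighbourhood `C` of `p`; the limit of their exit points is a point whose backward
orbit stays in `C`. -/
theorem Flow.exists_exit_point {φ : Flow ℝ α} {p q : α} (hp : ∀ t, φ t p = p)
    (h : (p, q) ∈ φ.prolongation) {C : Set α} (hC : IsClosed C) (hpC : C ∈ 𝓝 p) (hqC : q ∉ C) :
    ∃ y, y ∉ interior C ∧ (∀ t ≤ 0, φ t y ∈ C) ∧ (y, q) ∈ φ.prolongation := by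
  set G : Set (α × α) := {z | ∃ t, 0 ≤ t ∧ z.2 = φ t z.1}
  have hne : (𝓝[G] (p, q)).NeBot := mem_closure_iff_nhdsWithin_neBot.1 h
  have hpint : interior C ∈ 𝓝 p := interior_mem_nhds.2 hpC
  -- the first time at which the orbit is not in the interior of `C`
  have hexit : ∀ z : α × α, z ∈ G ∧ z.1 ∈ interior C ∧ z.2 ∉ C → ∃ s, 0 ≤ s ∧
      φ s z.1 ∉ interior C ∧ (∀ r, 0 ≤ r → r < s → φ r z.1 ∈ interior C) ∧ (φ s z.1, z.2) ∈ G := by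
    rintro ⟨u, w⟩ ⟨⟨t, ht, htw⟩, hu, hw⟩
    simp only at htw hu hw ⊢
    subst htw
    have hK : IsCompact (Icc 0 t ∩ (fun r => φ r u) ⁻¹' (interior C)ᶜ) :=
      isCompact_Icc.inter_right (isOpen_interior.isClosed_compl.preimage
        (φ.continuous continuous_id continuous_const))
    obtain ⟨s, ⟨hs, hsC⟩, hmin⟩ := hK.exists_isLeast ⟨t, ⟨ht, le_rfl⟩, fun hh => hw (interior_subset hh)⟩
    refine ⟨s, hs.1, hsC, fun r hr hrs => ?_, t - s, sub_nonneg.2 hs.2, ?_⟩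
    · by_contra hrC
      exact absurd (hmin ⟨⟨hr, hrs.le.trans hs.2⟩, hrC⟩) (not_le.2 hrs)
    · simp only
      rw [← φ.map_add, sub_add_cancel]
  choose! s hs0 hsC hsr hsG using hexit
  have hfst : Tendsto Prod.fst (𝓝 (p, q)) (𝓝 p) := continuous_fst.tendsto _
  have hsnd : Tendsto Prod.snd (𝓝 (p, q)) (𝓝 q) := continuous_snd.tendsto _
  have hgood : ∀ᶠ z in 𝓝[G] (p, q), z ∈ G ∧ z.1 ∈ interior C ∧ z.2 ∉ C := by
    refine Eventually.and eventually_mem_nhdsWithin (Eventually.and ?_ ?_)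
    · exact (hfst.eventually hpint).filter_mono nhdsWithin_le_nhds
    · exact (hsnd.eventually (hC.isOpen_compl.mem_nhds hqC)).filter_mono nhdsWithin_le_nhds
  let 𝒰 := Ultrafilter.of (𝓝[G] (p, q))
  have h𝒰 : (𝒰 : Filter (α × α)) ≤ 𝓝[G] (p, q) := Ultrafilter.of_le _
  obtain ⟨y, -, hy⟩ := isCompact_univ.ultrafilter_le_nhds (𝒰.map fun z => φ (s z) z.1) (by simp)
  have hy' : Tendsto (fun z : α × α => φ (s z) z.1) 𝒰 (𝓝 y) := hy
  refine ⟨y, ?_, fun t ht => ?_, ?_⟩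
  · refine isOpen_interior.isClosed_compl.mem_of_tendsto hy' ?_
    filter_upwards [h𝒰 hgood] with z hz using hsC z hz
  · have hlate : ∀ᶠ u in 𝓝 p, ∀ r ∈ Icc 0 (-t), φ r u ∈ interior C := by
      refine isCompact_Icc.eventually_forall_of_forall_eventually
        (P := fun u r => φ r u ∈ interior C) fun r _ => ?_
      have hc : ContinuousAt (fun z : α × ℝ => φ z.2 z.1) (p, r) :=
        (φ.continuous continuous_snd continuous_fst).continuousAt
      rw [ContinuousAt, hp] at hc
      exact hc.eventually hpint
    have hlate' : ∀ᶠ z : α × α in 𝓝[G] (p, q), ∀ r ∈ Icc 0 (-t), φ r z.1 ∈ interior C :=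
      (hfst.eventually hlate).filter_mono nhdsWithin_le_nhds
    have hty : Tendsto (fun z : α × α => φ t (φ (s z) z.1)) 𝒰 (𝓝 (φ t y)) :=
      ((φ.continuous continuous_const continuous_id).tendsto y).comp hy'
    refine hC.mem_of_tendsto hty ?_
    filter_upwards [h𝒰 hgood, h𝒰 hlate'] with z hz hzl
    have hts : -t < s z := by
      by_contra hcon
      exact hsC z hz (hzl _ ⟨hs0 z hz, not_lt.1 hcon⟩)
    rcases ht.eq_or_lt with rfl | ht
    · rw [← φ.map_add, zero_add]
      have hcl : φ (s z) z.1 ∈ closure (interior C) := by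
        have hcont : Continuous fun r => φ r z.1 := φ.continuous continuous_id continuous_const
        have : s z ∈ closure (Ico 0 (s z)) := by
          rw [closure_Ico (by linarith)]
          exact ⟨hs0 z hz, le_rfl⟩
        exact map_mem_closure (f := fun r => φ r z.1) hcont this fun r hr => hsr z hz r hr.1 hr.2
      exact closure_minimal interior_subset hC hcl
    · rw [← φ.map_add]
      exact interior_subset (hsr z hz _ (by linarith) (by linarith))
  · have hq : Tendsto (fun z : α × α => z.2) 𝒰 (𝓝 q) :=
      hsnd.mono_left (h𝒰.trans nhdsWithin_le_nhds)
    refine mem_closure_of_tendsto (hy'.prodMk_nhds hq) ?_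
    filter_upwards [h𝒰 hgood] with z hz using hsG z hz

namespace IsGradientLike

variable [T2Space α] {φ : Flow ℝ α} {f : α → ℝ} {S D : Set α}

/-- A set of rest points that is closed under connecting orbits is closed under prolongation:
limits of orbits are broken orbits. -/
theorem mem_of_mem_prolongation (h : IsGradientLike φ f S)
    (hD : ∀ x, ∀ p ∈ S, ∀ q ∈ S, Tendsto (fun t => φ t x) atBot (𝓝 p) →
      Tendsto (fun t => φ t x) atTop (𝓝 q) → p ∈ D → q ∈ D)
    {p q : α} (hp : p ∈ S) (hq : q ∈ S) (hpq : (p, q) ∈ φ.prolongation) (hpD : p ∈ D) : q ∈ D := by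
  induction hN : ({s ∈ S | f s < f p} : Set α).ncard using Nat.strong_induction_on generalizing p with
  | _ N ih =>
  by_cases hne : q = p
  · rwa [hne]
  have hcl : IsClosed (S \ {p}) := (h.finite.subset sdiff_subset).isClosed
  obtain ⟨C, ⟨hCp, hC⟩, hCS⟩ := (closed_nhds_basis p).mem_iff.1
    (hcl.isOpen_compl.mem_nhds (fun hh : p ∈ S \ {p} => hh.2 rfl))
  have hCeq : ∀ s ∈ S, s ∈ C → s = p := fun s hs hsC => by
    by_contra hsp
    exact hCS hsC ⟨hs, hsp⟩
  obtain ⟨y, hyC, hback, hyq⟩ := Flow.exists_exit_point (h.fixed p hp) hpq hC hCp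
    (fun hqC => hne (hCeq q hq hqC))
  obtain ⟨p₁, hp₁, hlim₁⟩ := h.exists_tendsto_atBot y
  obtain ⟨p₂, hp₂, hlim₂⟩ := h.exists_tendsto_atTop y
  have hp₁p : p₁ = p := hCeq p₁ hp₁ (hC.mem_of_tendsto hlim₁ (by
    filter_upwards [eventually_le_atBot 0] with t ht using hback t ht))
  subst hp₁p
  have hyS : y ∉ S := fun hyS => by
    have hyC' : y ∈ C := by simpa [φ.map_zero_apply] using hback 0 le_rfl
    rw [hCeq y hyS hyC'] at hyC
    exact hyC (mem_interior_iff_mem_nhds.2 hCp)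
  have hlt : f p₂ < f p₁ := h.lt_of_tendsto hyS hlim₁ hlim₂
  have hp₂q : (p₂, q) ∈ φ.prolongation := by
    refine isClosed_closure.mem_of_tendsto (hlim₂.prodMk_nhds tendsto_const_nhds) ?_
    filter_upwards [eventually_ge_atTop 0] with t ht
    exact Flow.map_mem_prolongation (h.fixed q hq) hyq ht
  refine ih _ ?_ hp₂ hp₂q (hD y p₁ hp₁ p₂ hp₂ hlim₁ hlim₂ hpD) rfl
  rw [← hN]
  refine ncard_lt_ncard ⟨fun s hs => ⟨hs.1, hs.2.trans hlt⟩, fun hsub => ?_⟩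
    (h.finite.subset fun s hs => hs.1)
  exact lt_irrefl _ (hsub ⟨hp₂, hlt⟩).2

/-- A set `D` of rest points that is closed under connecting orbits has an open neighbourhood whose
closure contains no other rest point and is mapped into it by the flow at a positive time. -/
theorem exists_trapping_nhd (h : IsGradientLike φ f S)
    (hD : ∀ x, ∀ p ∈ S, ∀ q ∈ S, Tendsto (fun t => φ t x) atBot (𝓝 p) →
      Tendsto (fun t => φ t x) atTop (𝓝 q) → p ∈ D → q ∈ D) :
    ∃ V : Set α, IsOpen V ∧ S ∩ D ⊆ V ∧ (∀ q ∈ S, q ∈ closure V → q ∈ D) ∧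
      ∃ T, 0 < T ∧ ∀ y ∈ closure V, φ T y ∈ V := by
  have hsub : (S ∩ D) ×ˢ (S \ D) ⊆ φ.prolongationᶜ := by
    rintro ⟨p, q⟩ ⟨hp, hq⟩ hpq
    exact hq.2 (h.mem_of_mem_prolongation hD hp.1 hq.1 hpq hp.2)
  obtain ⟨B, W, hB, hW, hDB, hDW, hBW⟩ := generalized_tube_lemma
    (h.finite.subset inter_subset_left).isCompact (h.finite.subset sdiff_subset).isCompact
    (isClosed_closure (s := {z : α × α | ∃ t, 0 ≤ t ∧ z.2 = φ t z.1})).isOpen_compl hsub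
  have hcont (t : ℝ) : Continuous (φ t) := φ.continuous continuous_const continuous_id
  let V : Set α := {x | ∃ t, 0 ≤ t ∧ φ (-t) x ∈ B}
  have hV : IsOpen V := by
    have : V = ⋃ t ∈ Ici (0 : ℝ), φ (-t) ⁻¹' B := by
      ext x; simp [V]
    rw [this]
    exact isOpen_biUnion fun t _ => hB.preimage (hcont _)
  have hfwd : ∀ t, 0 ≤ t → ∀ x ∈ V, φ t x ∈ V := by
    rintro t ht x ⟨s, hs, hx⟩
    refine ⟨t + s, add_nonneg ht hs, ?_⟩
    rw [← φ.map_add]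
    simpa using hx
  have hdis : Disjoint V W := by
    refine disjoint_left.2 ?_
    rintro x ⟨t, ht, hx⟩ hxW
    refine hBW (show (φ (-t) x, x) ∈ B ×ˢ W from ⟨hx, hxW⟩) (subset_closure ⟨t, ht, ?_⟩)
    simp only
    rw [← φ.map_add, add_neg_cancel, φ.map_zero_apply]
  have hVD : ∀ q ∈ S, q ∈ closure V → q ∈ D := fun q hq hqV => by
    by_contra hqD
    exact disjoint_left.1 (hdis.closure_left hW) hqV (hDW ⟨hq, hqD⟩)
  have hDV : S ∩ D ⊆ V := fun p hp => ⟨0, le_rfl, by simpa [φ.map_zero_apply] using hDB hp⟩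
  refine ⟨V, hV, hDV, hVD, ?_⟩
  have hcov : closure V ⊆ ⋃ t : Ici (0 : ℝ), φ t ⁻¹' V := by
    intro y hy
    obtain ⟨p, hp, hlim⟩ := h.exists_tendsto_atTop y
    have hpV : p ∈ closure V := by
      refine isClosed_closure.mem_of_tendsto hlim ?_
      filter_upwards [eventually_ge_atTop 0] with t ht
      exact map_mem_closure (hcont t) hy fun x hx => hfwd t ht x hx
    have hev := hlim.eventually (hV.mem_nhds (hDV ⟨hp, hVD p hp hpV⟩))
    obtain ⟨t, ht, ht0⟩ := (hev.and (eventually_ge_atTop 0)).exists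
    exact mem_iUnion.2 ⟨⟨t, ht0⟩, ht⟩
  have : Nonempty (Ici (0 : ℝ)) := ⟨⟨0, self_mem_Ici⟩⟩
  have hmono : Monotone fun t : Ici (0 : ℝ) => φ t ⁻¹' V := fun s t hst x hx => by
    have := hfwd (t - s) (sub_nonneg.2 hst) _ hx
    rwa [← φ.map_add, sub_add_cancel] at this
  obtain ⟨T, hT⟩ := isClosed_closure.isCompact.elim_directed_cover _
    (fun t => hV.preimage (hcont _)) hcov hmono.directed_le
  refine ⟨T + 1, add_pos_of_nonneg_of_pos T.2 one_pos, fun y hy => ?_⟩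
  have := hfwd 1 zero_le_one _ (hT hy)
  rwa [← φ.map_add, add_comm] at this

end IsGradientLike

end GradientLikeFlow

/-! ### The negative index along a segment of bilinear forms -/

section Signature
set_option maxSynthPendingDepth 3
open Set Filter

variable {E : Type*} [NormedAddCommGroup E] [NormedSpace ℝ E] [FiniteDimensional ℝ E]

omit [FiniteDimensional ℝ E] in
theorem toBilinForm_toQuadraticMap_apply (T : E →L[ℝ] E →L[ℝ] ℝ) (v : E) :
    T.toBilinForm.toQuadraticMap v = T v v := rfl

/-- The positive index of inertia of a continuous bilinear form is lower semicontinuous. -/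
theorem eventually_sigPos_le (T₀ : E →L[ℝ] E →L[ℝ] ℝ) :
    ∀ᶠ T in 𝓝 T₀, sigPos T₀.toBilinForm.toQuadraticMap ≤ sigPos T.toBilinForm.toQuadraticMap := by
  obtain ⟨V, hVr, hV⟩ := exists_finrank_eq_sigPos_and_posDef T₀.toBilinForm.toQuadraticMap
  have hK : IsCompact ((V : Set E) ∩ Metric.sphere 0 1) :=
    have := FiniteDimensional.proper_real E
    (isCompact_sphere 0 1).inter_left V.closed_of_finiteDimensional
  have hpos : ∀ᶠ T in 𝓝 T₀, ∀ v ∈ (V : Set E) ∩ Metric.sphere 0 1, 0 < T v v := by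
    refine hK.eventually_forall_of_forall_eventually
      (P := fun (T : E →L[ℝ] E →L[ℝ] ℝ) v => 0 < T v v) fun v hv => ?_
    have hc : Continuous fun z : (E →L[ℝ] E →L[ℝ] ℝ) × E => z.1 z.2 z.2 := by fun_prop
    refine (hc.tendsto (T₀, v)).eventually (lt_mem_nhds ?_)
    have hv0 : (⟨v, hv.1⟩ : V) ≠ 0 := fun h => by
      have h0 : v = 0 := congrArg Subtype.val h
      have := hv.2
      rw [h0] at this
      simp at this
    exact hV _ hv0
  filter_upwards [hpos] with T hT
  rw [← hVr]
  refine le_sigPos_of_posDef _ fun v hv => ?_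
  have hv0 : (v : E) ≠ 0 := fun h => hv (Subtype.ext h)
  have hn : 0 < ‖(v : E)‖ := norm_pos_iff.2 hv0
  have h1 := hT (‖(v : E)‖⁻¹ • (v : E)) ⟨V.smul_mem _ v.2, by
    rw [mem_sphere_zero_iff_norm, norm_smul, norm_inv, norm_norm, inv_mul_cancel₀ hn.ne']⟩
  simp only [map_smul, smul_apply, smul_eq_mul] at h1
  rw [← mul_assoc] at h1
  exact pos_of_mul_pos_right h1 (by positivity)

theorem eventually_sigNeg_le (T₀ : E →L[ℝ] E →L[ℝ] ℝ) :
    ∀ᶠ T in 𝓝 T₀, sigNeg T₀.toBilinForm.toQuadraticMap ≤ sigNeg T.toBilinForm.toQuadraticMap :=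
  (continuous_neg.tendsto T₀).eventually (eventually_sigPos_le (-T₀))

theorem sigPos_add_sigNeg_of_nondegenerate {T : E →L[ℝ] E →L[ℝ] ℝ} (hsymm : ∀ v w, T v w = T w v)
    (hT : ∀ v, (∀ w, T v w = 0) → v = 0) :
    sigPos T.toBilinForm.toQuadraticMap + sigNeg T.toBilinForm.toQuadraticMap =
      Module.finrank ℝ E := by
  rw [← QuadraticForm.sigPos_add_sigNeg_add_radical (Q := T.toBilinForm.toQuadraticMap)]
  have : (T.toBilinForm.toQuadraticMap).radical = ⊥ := by
    have : Invertible (2 : ℝ) := invertibleOfNonzero two_ne_zero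
    rw [QuadraticMap.radical_eq_ker_polarBilin, eq_bot_iff]
    intro v hv
    refine hT v fun w => ?_
    have h1 : QuadraticMap.polar T.toBilinForm.toQuadraticMap v w = 0 :=
      congrArg (fun φ => φ w) (LinearMap.mem_ker.1 hv)
    simp only [QuadraticMap.polar, toBilinForm_toQuadraticMap_apply, map_add,
      add_apply] at h1
    have h2 := hsymm v w
    linarith
  rw [this]
  simp

/-- Two symmetric bilinear forms for which one and the same operator is strictly dissipative have
the same negative index: the segment between them consists of nondegenerate forms. -/
theorem sigNeg_eq_of_dissipative {T₀ T₁ : E →L[ℝ] E →L[ℝ] ℝ} (h₀ : ∀ v w, T₀ v w = T₀ w v)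
    (h₁ : ∀ v w, T₁ v w = T₁ w v) (A : E → E) (hA₀ : ∀ v, v ≠ 0 → T₀ v (A v) < 0)
    (hA₁ : ∀ v, v ≠ 0 → T₁ v (A v) < 0) :
    sigNeg T₀.toBilinForm.toQuadraticMap = sigNeg T₁.toBilinForm.toQuadraticMap := by
  let T : ℝ → E →L[ℝ] E →L[ℝ] ℝ := fun s => (1 - s) • T₀ + s • T₁
  have hT : Continuous T := by fun_prop
  have hsum : ∀ s ∈ Icc (0 : ℝ) 1, sigPos (T s).toBilinForm.toQuadraticMap +
      sigNeg (T s).toBilinForm.toQuadraticMap = Module.finrank ℝ E := by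
    intro s hs
    refine sigPos_add_sigNeg_of_nondegenerate (fun v w => ?_) fun v hv => ?_
    · simp [T, h₀ v w, h₁ v w]
    · by_contra hv0
      have h := hv (A v)
      simp only [T, add_apply, smul_apply,
        smul_eq_mul] at h
      have h2 := hA₀ v hv0
      have h3 := hA₁ v hv0
      rcases hs.1.eq_or_lt with rfl | hs0
      · linarith
      · nlinarith [mul_pos hs0 (neg_pos.2 h3), mul_nonneg (sub_nonneg.2 hs.2) (neg_pos.2 h2).le]
  have hcont : ContinuousOn (fun s => sigNeg (T s).toBilinForm.toQuadraticMap) (Icc 0 1) := by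
    intro s hs
    refine Tendsto.congr' (f₁ := fun _ => sigNeg (T s).toBilinForm.toQuadraticMap) ?_
      tendsto_const_nhds
    filter_upwards [((hT.tendsto s).mono_left nhdsWithin_le_nhds).eventually (eventually_sigPos_le _),
      ((hT.tendsto s).mono_left nhdsWithin_le_nhds).eventually (eventually_sigNeg_le _),
      self_mem_nhdsWithin] with r hr1 hr2 hr
    have e1 := hsum s hs
    have e2 := hsum r hr
    omega
  have := isPreconnected_Icc.constant hcont (left_mem_Icc.2 zero_le_one) (right_mem_Icc.2 zero_le_one)
  simpa [T] using this

end Signature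

/-! ### Critical points of functions with a pseudo-gradient -/

section CriticalPoints
set_option maxSynthPendingDepth 3
open Set Filter

variable {n : ℕ} {M : Type*} [TopologicalSpace M] [ChartedSpace (EuclideanSpace ℝ (Fin n)) M]

theorem Filter.EventuallyEq.hessianAt_eq {f g : M → ℝ} {p : M} (h : f =ᶠ[𝓝 p] g) :
    hessianAt n f p = hessianAt n g p := by
  have h1 : f ∘ (extChartAt (𝓡 n) p).symm =ᶠ[𝓝 (extChartAt (𝓡 n) p p)]
      g ∘ (extChartAt (𝓡 n) p).symm := by
    have hc := continuousAt_extChartAt_symm (I := 𝓡 n) p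
    rw [ContinuousAt, extChartAt_to_inv] at hc
    exact hc.eventually h
  exact h1.fderiv.fderiv_eq

theorem hessianAt_const_mul_add_const (a c : ℝ) (f : M → ℝ) (p : M) :
    hessianAt n (fun x => a * f x + c) p = a • hessianAt n f p := by
  have h1 : fderiv ℝ ((fun x => a * f x + c) ∘ (extChartAt (𝓡 n) p).symm) =
      a • fderiv ℝ (f ∘ (extChartAt (𝓡 n) p).symm) := by
    rw [← fderiv_const_smul_field]
    funext y
    exact fderiv_add_const (f := a • (f ∘ (extChartAt (𝓡 n) p).symm)) c
  rw [hessianAt, h1, fderiv_const_smul_field]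
  rfl

variable [IsManifold (𝓡 n) ∞ M]

theorem contDiffAt_comp_extChartAt_symm {f : M → ℝ} (hf : ContMDiff (𝓡 n) 𝓘(ℝ, ℝ) ∞ f) {p : M}
    {y : EuclideanSpace ℝ (Fin n)} (hy : y ∈ (extChartAt (𝓡 n) p).target) :
    ContDiffAt ℝ ∞ (f ∘ (extChartAt (𝓡 n) p).symm) y :=
  ((hf _).comp y ((contMDiffOn_extChartAt_symm p).contMDiffAt
    (extChartAt_target_mem_nhds' hy))).contDiffAt

theorem hessianAt_symm {f : M → ℝ} (hf : ContMDiff (𝓡 n) 𝓘(ℝ, ℝ) ∞ f) (p : M)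
    (v w : EuclideanSpace ℝ (Fin n)) : hessianAt n f p v w = hessianAt n f p w v :=
  ((contDiffAt_comp_extChartAt_symm hf (mem_extChartAt_target p)).isSymmSndFDerivAt
    (by simpa using WithTop.coe_le_coe.2 (le_top : (2 : ℕ∞) ≤ ⊤))) v w

/-- The differential of a function, computed in the chart at `p`. -/
theorem mfderiv_apply_eq_fderiv {f : M → ℝ} (hf : ContMDiff (𝓡 n) 𝓘(ℝ, ℝ) ∞ f) {p x : M}
    (hx : x ∈ (extChartAt (𝓡 n) p).source) (u : TangentSpace (𝓡 n) x) :
    (mfderiv (𝓡 n) 𝓘(ℝ, ℝ) f x : TangentSpace (𝓡 n) x →L[ℝ] ℝ) u =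
      fderiv ℝ (f ∘ (extChartAt (𝓡 n) p).symm) (extChartAt (𝓡 n) p x)
        (tangentCoordChange (𝓡 n) x p x u) := by
  have hd : DifferentiableAt ℝ (f ∘ (extChartAt (𝓡 n) p).symm) (extChartAt (𝓡 n) p x) :=
    (contDiffAt_comp_extChartAt_symm hf ((extChartAt (𝓡 n) p).map_source hx)).differentiableAt
      (by simp)
  have hx' := hx
  rw [extChartAt_source] at hx'
  have h := HasMFDerivAt.comp x hd.hasFDerivAt.hasMFDerivAt (hasMFDerivAt_extChartAt (I := 𝓡 n) hx')
  have heq : f =ᶠ[𝓝 x] (f ∘ (extChartAt (𝓡 n) p).symm) ∘ extChartAt (𝓡 n) p := by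
    filter_upwards [(isOpen_extChartAt_source (I := 𝓡 n) p).mem_nhds hx] with z hz
    simp only [Function.comp_apply, (extChartAt (𝓡 n) p).left_inv hz]
  rw [(h.congr_of_eventuallyEq heq).mfderiv, mfderiv_chartAt_eq_tangentCoordChange hx']
  rfl

theorem isCritical_iff_fderiv_eq_zero {f : M → ℝ} (hf : ContMDiff (𝓡 n) 𝓘(ℝ, ℝ) ∞ f) {p x : M}
    (hx : x ∈ (extChartAt (𝓡 n) p).source) :
    IsCritical n f x ↔
      fderiv ℝ (f ∘ (extChartAt (𝓡 n) p).symm) (extChartAt (𝓡 n) p x) = 0 := by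
  have hxx := mem_extChartAt_source (I := 𝓡 n) x
  constructor
  · intro h
    ext v
    have h1 := mfderiv_apply_eq_fderiv hf hx (tangentCoordChange (𝓡 n) p x x v)
    rw [tangentCoordChange_comp ⟨⟨hx, hxx⟩, hx⟩, tangentCoordChange_self hx, h] at h1
    exact h1.symm
  · intro h
    refine ContinuousLinearMap.ext fun u => ?_
    refine (mfderiv_apply_eq_fderiv hf hx u).trans ?_
    rw [h]
    rfl

theorem vectorDeriv_eq_fderiv {X : ∀ x : M, TangentSpace (𝓡 n) x} {f : M → ℝ}
    (hf : ContMDiff (𝓡 n) 𝓘(ℝ, ℝ) ∞ f) {p : M} {y : EuclideanSpace ℝ (Fin n)}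
    (hy : y ∈ (extChartAt (𝓡 n) p).target) :
    vectorDeriv X f ((extChartAt (𝓡 n) p).symm y) =
      fderiv ℝ (f ∘ (extChartAt (𝓡 n) p).symm) y (vectorFieldInChart X p y) := by
  have h := mfderiv_apply_eq_fderiv hf ((extChartAt (𝓡 n) p).map_target hy)
    (X ((extChartAt (𝓡 n) p).symm y))
  rw [(extChartAt (𝓡 n) p).right_inv hy] at h
  exact h

theorem vectorFieldInChart_self (X : ∀ x : M, TangentSpace (𝓡 n) x) (p : M) :
    vectorFieldInChart X p (extChartAt (𝓡 n) p p) = X p := by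
  rw [vectorFieldInChart, extChartAt_to_inv]
  exact tangentCoordChange_self (mem_extChartAt_source p)

/-- Critical points of a Morse function are isolated. -/
theorem IsMorse.eventually_not_isCritical {f : M → ℝ} (hf : IsMorse n f) (p : M) :
    ∀ᶠ x in 𝓝[≠] p, ¬ IsCritical n f x := by
  set y₀ := extChartAt (𝓡 n) p p with hy₀
  set F := f ∘ (extChartAt (𝓡 n) p).symm
  have hd : ContDiffAt ℝ ∞ F y₀ := contDiffAt_comp_extChartAt_symm hf.1 (mem_extChartAt_target p)
  have hd1 : ContDiffAt ℝ ∞ (fderiv ℝ F) y₀ := hd.fderiv_right (m := ∞) (by simp)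
  have hkey : ∀ᶠ y in 𝓝[≠] y₀, fderiv ℝ F y ≠ 0 := by
    by_cases hp : IsCritical n f p
    · have hinj : Function.Injective (hessianAt n f p) :=
        (injective_iff_map_eq_zero _).2 fun v hv => hf.2 p hp v fun w => by rw [hv]; rfl
      have hH : HasFDerivAt (fderiv ℝ F) (hessianAt n f p) y₀ :=
        (hd1.differentiableAt (by simp)).hasFDerivAt
      obtain ⟨K, -, hK⟩ := (hessianAt n f p).toLinearMap.exists_antilipschitzWith
        (LinearMap.ker_eq_bot.2 hinj)
      exact hH.eventually_ne ⟨K, hK⟩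
    · rw [isCritical_iff_fderiv_eq_zero hf.1 (mem_extChartAt_source p)] at hp
      exact (hd1.continuousAt.eventually_ne hp).filter_mono nhdsWithin_le_nhds
  have hsrc : ∀ᶠ x in 𝓝[≠] p, x ∈ (extChartAt (𝓡 n) p).source :=
    nhdsWithin_le_nhds (extChartAt_source_mem_nhds (I := 𝓡 n) p)
  have htend : Tendsto (extChartAt (𝓡 n) p) (𝓝[≠] p) (𝓝[≠] y₀) := by
    refine tendsto_nhdsWithin_iff.2
      ⟨(continuousAt_extChartAt p).mono_left nhdsWithin_le_nhds, ?_⟩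
    filter_upwards [hsrc, self_mem_nhdsWithin] with x hx hxp hxy
    exact hxp ((extChartAt (𝓡 n) p).injOn hx (mem_extChartAt_source p) hxy)
  filter_upwards [htend.eventually hkey, hsrc] with x hx hxs hcrit
  exact hx ((isCritical_iff_fderiv_eq_zero hf.1 hxs).1 hcrit)

theorem IsMorse.finite_setOf_isCritical [CompactSpace M] {f : M → ℝ} (hf : IsMorse n f) :
    {p | IsCritical n f p}.Finite := by
  by_contra hinf
  obtain ⟨x, hx⟩ := Set.Infinite.exists_accPt_principal hinf
  have h := accPt_iff_frequently_nhdsNE.1 hx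
  exact h (hf.eventually_not_isCritical x)

theorem IsPseudoGradient.vectorDeriv_nonpos {X : ∀ x : M, TangentSpace (𝓡 n) x} {f : M → ℝ}
    (h : IsPseudoGradient X f) (x : M) : vectorDeriv X f x ≤ 0 := by
  by_cases hx : IsCritical n f x
  · rw [IsCritical] at hx
    rw [vectorDeriv, hx]
    rfl
  · exact (h.neg x hx).le

theorem eventuallyEq_vectorDeriv_comp {X : ∀ x : M, TangentSpace (𝓡 n) x} {f : M → ℝ}
    (hf : ContMDiff (𝓡 n) 𝓘(ℝ, ℝ) ∞ f) (p : M) :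
    vectorDeriv X f ∘ (extChartAt (𝓡 n) p).symm =ᶠ[𝓝 (extChartAt (𝓡 n) p p)]
      fun y => fderiv ℝ (f ∘ (extChartAt (𝓡 n) p).symm) y (vectorFieldInChart X p y) := by
  filter_upwards [extChartAt_target_mem_nhds (I := 𝓡 n) p] with y hy
  exact vectorDeriv_eq_fderiv hf hy

/-- A pseudo-gradient of a Morse function vanishes at the critical points: `X · f` is maximal
there, and its differential is `hessianAt n f p · (X p)`. -/
theorem IsPseudoGradient.eq_zero_of_isCritical {X : ∀ x : M, TangentSpace (𝓡 n) x} {f : M → ℝ}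
    (hf : IsMorse n f) (h : IsPseudoGradient X f) {p : M} (hp : IsCritical n f p) : X p = 0 := by
  set y₀ := extChartAt (𝓡 n) p p with hy₀
  set F := f ∘ (extChartAt (𝓡 n) p).symm with hF
  set V := vectorFieldInChart X p
  have hd : ContDiffAt ℝ ∞ F y₀ := contDiffAt_comp_extChartAt_symm hf.1 (mem_extChartAt_target p)
  have hd1 : ContDiffAt ℝ ∞ (fderiv ℝ F) y₀ := hd.fderiv_right (m := ∞) (by simp)
  have hV : ContDiffAt ℝ ∞ V y₀ := contDiffAt_vectorFieldInChart h.smooth p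
  have hcrit : fderiv ℝ F y₀ = 0 :=
    (isCritical_iff_fderiv_eq_zero hf.1 (mem_extChartAt_source p)).1 hp
  have hW := (hd1.differentiableAt (by simp)).hasFDerivAt.clm_apply
    (hV.differentiableAt (by simp)).hasFDerivAt
  have hmax : IsLocalMax (fun y => fderiv ℝ F y (V y)) y₀ := by
    filter_upwards [eventuallyEq_vectorDeriv_comp (X := X) hf.1 p] with y hy
    rw [hcrit, ← hy]
    exact h.vectorDeriv_nonpos _
  have h0 := hmax.hasFDerivAt_eq_zero hW
  rw [← vectorFieldInChart_self X p]
  refine hf.2 p hp _ fun w => ?_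
  rw [hessianAt_symm hf.1]
  have h1 := congrArg (fun T : EuclideanSpace ℝ (Fin n) →L[ℝ] ℝ => T w) h0
  rw [hcrit] at h1
  have h2 : fderiv ℝ (fderiv ℝ F) y₀ w (V y₀) = 0 := by simpa using h1
  exact h2

theorem IsPseudoGradient.isCritical_iff {X : ∀ x : M, TangentSpace (𝓡 n) x} {f : M → ℝ}
    (hf : IsMorse n f) (h : IsPseudoGradient X f) {p : M} : IsCritical n f p ↔ X p = 0 := by
  refine ⟨h.eq_zero_of_isCritical hf, fun hX => ?_⟩
  by_contra hp
  have := h.neg p hp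
  rw [vectorDeriv, hX, map_zero] at this
  exact lt_irrefl _ this

/-- At a critical point, the Hessian of `X · f` is twice the Hessian of `f` composed with the
linear part of `X`. -/
theorem IsPseudoGradient.hessianAt_vectorDeriv {X : ∀ x : M, TangentSpace (𝓡 n) x} {f : M → ℝ}
    (hf : IsMorse n f) (h : IsPseudoGradient X f) {p : M} (hp : IsCritical n f p)
    (u : EuclideanSpace ℝ (Fin n)) :
    hessianAt n (vectorDeriv X f) p u u =
      2 * hessianAt n f p u (fderiv ℝ (vectorFieldInChart X p) (extChartAt (𝓡 n) p p) u) := by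
  set y₀ := extChartAt (𝓡 n) p p with hy₀
  set F := f ∘ (extChartAt (𝓡 n) p).symm with hF
  set V := vectorFieldInChart X p with hVdef
  have hd : ContDiffAt ℝ ∞ F y₀ := contDiffAt_comp_extChartAt_symm hf.1 (mem_extChartAt_target p)
  have hd1 : ContDiffAt ℝ ∞ (fderiv ℝ F) y₀ := hd.fderiv_right (m := ∞) (by simp)
  have hd2 : ContDiffAt ℝ ∞ (fderiv ℝ (fderiv ℝ F)) y₀ := hd1.fderiv_right (m := ∞) (by simp)
  have hV : ContDiffAt ℝ ∞ V y₀ := contDiffAt_vectorFieldInChart h.smooth p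
  have hV1 : ContDiffAt ℝ ∞ (fderiv ℝ V) y₀ := hV.fderiv_right (m := ∞) (by simp)
  have hcrit : fderiv ℝ F y₀ = 0 :=
    (isCritical_iff_fderiv_eq_zero hf.1 (mem_extChartAt_source p)).1 hp
  have hV0 : V y₀ = 0 := by
    rw [hVdef, hy₀, vectorFieldInChart_self, h.eq_zero_of_isCritical hf hp]
    rfl
  let W := fun y => fderiv ℝ F y (V y)
  have hWd : ContDiffAt ℝ ∞ W y₀ := hd1.clm_apply hV
  have hW1 : ContDiffAt ℝ ∞ (fderiv ℝ W) y₀ := hWd.fderiv_right (m := ∞) (by simp)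
  have hle : (1 : WithTop ℕ∞) ≤ ∞ := by exact_mod_cast le_top
  have hfirst : (fun y => fderiv ℝ W y u) =ᶠ[𝓝 y₀]
      fun y => fderiv ℝ F y (fderiv ℝ V y u) + fderiv ℝ (fderiv ℝ F) y u (V y) := by
    filter_upwards [(hd1.of_le hle).eventually (by simp), (hV.of_le hle).eventually (by simp)]
      with y hy1 hy2
    have hWy := (hy1.differentiableAt (by simp)).hasFDerivAt.clm_apply
      (hy2.differentiableAt (by simp)).hasFDerivAt
    rw [hWy.fderiv]
    simp
  have hhess : hessianAt n (vectorDeriv X f) p u u = fderiv ℝ (fun y => fderiv ℝ W y u) y₀ u := by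
    rw [hessianAt, ((eventuallyEq_vectorDeriv_comp (X := X) hf.1 p).fderiv).fderiv_eq]
    have := (hW1.differentiableAt (by simp)).hasFDerivAt.clm_apply (hasFDerivAt_const u y₀)
    rw [this.fderiv]
    simp [W, F, V, y₀]
  have hVu : HasFDerivAt (fun y => fderiv ℝ V y u) ((fderiv ℝ (fderiv ℝ V) y₀).flip u) y₀ := by
    simpa using (hV1.differentiableAt (by simp)).hasFDerivAt.clm_apply (hasFDerivAt_const u y₀)
  have hFu : HasFDerivAt (fun y => fderiv ℝ (fderiv ℝ F) y u)
      ((fderiv ℝ (fderiv ℝ (fderiv ℝ F)) y₀).flip u) y₀ := by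
    simpa using (hd2.differentiableAt (by simp)).hasFDerivAt.clm_apply (hasFDerivAt_const u y₀)
  have hsecond := ((hd1.differentiableAt (by simp)).hasFDerivAt.clm_apply hVu).add
    (hFu.clm_apply (hV.differentiableAt (by simp)).hasFDerivAt)
  rw [hhess, hfirst.fderiv_eq, HasFDerivAt.fderiv (f := fun y =>
    fderiv ℝ F y (fderiv ℝ V y u) + fderiv ℝ (fderiv ℝ F) y u (V y)) hsecond, hcrit, hV0, two_mul]
  simp
  rfl

/-- The index at a critical point is determined by the pseudo-gradient. -/
theorem IsPseudoGradient.morseIndex_eq {X : ∀ x : M, TangentSpace (𝓡 n) x} {f g : M → ℝ}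
    (hf : IsMorse n f) (hg : IsMorse n g) (hXf : IsPseudoGradient X f) (hXg : IsPseudoGradient X g)
    {p : M} (hp : IsCritical n f p) : morseIndex n f p = morseIndex n g p := by
  have hp' : IsCritical n g p := (hXg.isCritical_iff hg).2 ((hXf.isCritical_iff hf).1 hp)
  refine sigNeg_eq_of_dissipative (hessianAt_symm hf.1 p) (hessianAt_symm hg.1 p)
    (fderiv ℝ (vectorFieldInChart X p) (extChartAt (𝓡 n) p p)) (fun v hv => ?_) (fun v hv => ?_)
  · have := hXf.hessian_neg p hp v hv
    rw [hXf.hessianAt_vectorDeriv hf hp] at this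
    linarith
  · have := hXg.hessian_neg p hp' v hv
    rw [hXg.hessianAt_vectorDeriv hg hp'] at this
    linarith

omit [IsManifold (𝓡 n) ∞ M] in
theorem HasMFDerivAt.const_mul_add {f g : M → ℝ} {x : M} {Df Dg : TangentSpace (𝓡 n) x →L[ℝ] ℝ}
    (hf : HasMFDerivAt (𝓡 n) 𝓘(ℝ, ℝ) f x Df) (hg : HasMFDerivAt (𝓡 n) 𝓘(ℝ, ℝ) g x Dg) (a : ℝ) :
    HasMFDerivAt (𝓡 n) 𝓘(ℝ, ℝ) (fun x => a * f x + g x) x (a • Df + Dg) :=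
  (hf.const_smul a).add hg

omit [IsManifold (𝓡 n) ∞ M] in
theorem vectorDeriv_const_mul_add (X : ∀ x : M, TangentSpace (𝓡 n) x) {f g : M → ℝ}
    (hf : ContMDiff (𝓡 n) 𝓘(ℝ, ℝ) ∞ f) (hg : ContMDiff (𝓡 n) 𝓘(ℝ, ℝ) ∞ g) (a : ℝ) (x : M) :
    vectorDeriv X (fun x => a * f x + g x) x = a * vectorDeriv X f x + vectorDeriv X g x := by
  rw [vectorDeriv, ((hf.mdifferentiable (by simp) x).hasMFDerivAt.const_mul_add
    (hg.mdifferentiable (by simp) x).hasMFDerivAt a).mfderiv]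
  rfl

/-- Adding to a positive multiple of `f` a function that is not increased by the flow and is
constant near each critical point changes neither the pseudo-gradients nor the critical points. -/
theorem IsPseudoGradient.const_mul_add {X : ∀ x : M, TangentSpace (𝓡 n) x} {f g : M → ℝ}
    (hf : IsMorse n f) (h : IsPseudoGradient X f) (hg : ContMDiff (𝓡 n) 𝓘(ℝ, ℝ) ∞ g)
    (hgX : ∀ x, vectorDeriv X g x ≤ 0)
    (hgc : ∀ p, IsCritical n f p → ∃ c, ∀ᶠ x in 𝓝 p, g x = c) {a : ℝ} (ha : 0 < a) :
    IsMorse n (fun x => a * f x + g x) ∧ IsPseudoGradient X (fun x => a * f x + g x) := by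
  set k : M → ℝ := fun x => a * f x + g x with hk
  have hksm : ContMDiff (𝓡 n) 𝓘(ℝ, ℝ) ∞ k := (contMDiff_const.mul hf.1).add hg
  have hvd (x : M) : vectorDeriv X k x = a * vectorDeriv X f x + vectorDeriv X g x :=
    vectorDeriv_const_mul_add X hf.1 hg a x
  have hgcrit : ∀ p, IsCritical n f p → mfderiv (𝓡 n) 𝓘(ℝ, ℝ) g p = 0 := fun p hp => by
    obtain ⟨c, hc⟩ := hgc p hp
    have : g =ᶠ[𝓝 p] fun _ => c := hc
    exact this.mfderiv_eq.trans mfderiv_const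
  have hcrit : ∀ p, IsCritical n k p ↔ IsCritical n f p := fun p => by
    constructor
    · intro hp
      by_contra hpf
      have h1 : vectorDeriv X k p < 0 := by
        rw [hvd]
        have := mul_neg_of_pos_of_neg ha (h.neg p hpf)
        linarith [hgX p]
      rw [vectorDeriv, hp] at h1
      exact lt_irrefl _ h1
    · intro hp
      have h1 : HasMFDerivAt (𝓡 n) 𝓘(ℝ, ℝ) f p (0 : TangentSpace (𝓡 n) p →L[ℝ] ℝ) :=
        hp ▸ (hf.1.mdifferentiable (by simp) p).hasMFDerivAt
      have h2 : HasMFDerivAt (𝓡 n) 𝓘(ℝ, ℝ) g p (0 : TangentSpace (𝓡 n) p →L[ℝ] ℝ) :=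
        hgcrit p hp ▸ (hg.mdifferentiable (by simp) p).hasMFDerivAt
      rw [IsCritical, (h1.const_mul_add h2 a).mfderiv, smul_zero, add_zero]
      rfl
  have hlocal : ∀ p, IsCritical n f p → ∃ c, k =ᶠ[𝓝 p] fun x => a * f x + c := fun p hp => by
    obtain ⟨c, hc⟩ := hgc p hp
    exact ⟨c, by filter_upwards [hc] with x hx; simp only [hk, hx]⟩
  have hlocalX : ∀ p, IsCritical n f p →
      vectorDeriv X k =ᶠ[𝓝 p] fun x => a * vectorDeriv X f x + 0 := fun p hp => by
    obtain ⟨c, hc⟩ := hgc p hp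
    filter_upwards [hc.eventually_nhds] with x hx
    have hx' : g =ᶠ[𝓝 x] fun _ => c := hx
    have : vectorDeriv X g x = 0 := by
      rw [vectorDeriv, hx'.mfderiv_eq, mfderiv_const]
      rfl
    rw [hvd, this]
  refine ⟨⟨hksm, fun p hp v hv => ?_⟩, ⟨h.smooth, fun x hx => ?_, fun p hp v hv => ?_⟩⟩
  · rw [hcrit] at hp
    obtain ⟨c, hc⟩ := hlocal p hp
    refine hf.2 p hp v fun w => ?_
    have := hv w
    rw [hc.hessianAt_eq, hessianAt_const_mul_add_const] at this
    exact (mul_eq_zero.1 this).resolve_left ha.ne'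
  · rw [hcrit] at hx
    rw [hvd]
    have := mul_neg_of_pos_of_neg ha (h.neg x hx)
    linarith [hgX x]
  · rw [hcrit] at hp
    rw [(hlocalX p hp).hessianAt_eq, hessianAt_const_mul_add_const]
    exact mul_neg_of_pos_of_neg ha (h.hessian_neg p hp v hv)

end CriticalPoints

/-! ### Prescribing the critical values -/

section MorsePaths
open Set Filter

variable {n : ℕ} {M : Type*} [TopologicalSpace M] [T2Space M] [CompactSpace M]
  [ChartedSpace (EuclideanSpace ℝ (Fin n)) M] [IsManifold (𝓡 n) ∞ M]
  {X : ∀ x : M, TangentSpace (𝓡 n) x} {f : M → ℝ}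

theorem IsPseudoGradient.flowMap_eq_self (hf : IsMorse n f) (h : IsPseudoGradient X f) {p : M}
    (hp : IsCritical n f p) (t : ℝ) : flowMap h.smooth (t, p) = p :=
  (eq_flowMap_of_isMIntegralCurve h.smooth
    (isMIntegralCurve_const (h.eq_zero_of_isCritical hf hp)) t).symm

theorem IsPseudoGradient.isGradientLike (hf : IsMorse n f) (h : IsPseudoGradient X f) :
    IsGradientLike (flowOfVectorField h.smooth) f {p | IsCritical n f p} where
  continuous := hf.1.continuous
  finite := hf.finite_setOf_isCritical
  fixed p hp t := h.flowMap_eq_self hf hp t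
  lt x hx t ht := by
    have hns : ∀ s, ¬ IsCritical n f (flowMap h.smooth (s, x)) := fun s hs => by
      have h1 := h.flowMap_eq_self hf hs (-s)
      rw [← flowMap_add, neg_add_cancel, flowMap_zero] at h1
      rw [← h1] at hs
      exact hx hs
    have hd (s : ℝ) := (isMIntegralCurve_flowMap h.smooth x).hasDerivAt_comp (t := s)
      (hf.1.mdifferentiable (by simp) _)
    have hanti := strictAnti_of_hasDerivAt_neg hd fun s => h.neg _ (hns s)
    have h2 := hanti ht
    simp only [flowMap_zero] at h2
    exact h2

/-- A pseudo-gradient orbit connects a critical point to one with a smaller value. -/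
theorem IsPseudoGradient.lt_of_hasConnectingOrbit (hf : IsMorse n f) (h : IsPseudoGradient X f)
    {p q : M} (hpq : p ≠ q) (hconn : HasConnectingOrbit X p q) : f q < f p := by
  obtain ⟨γ, hγ, hp, hq⟩ := hconn
  have hγφ : γ = fun t => flowOfVectorField h.smooth t (γ 0) :=
    funext fun t => eq_flowMap_of_isMIntegralCurve h.smooth hγ t
  rw [hγφ] at hp hq
  refine (h.isGradientLike hf).lt_of_tendsto (fun hcrit => hpq ?_) hp hq
  have hconst : (fun t => flowOfVectorField h.smooth t (γ 0)) = fun _ => γ 0 :=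
    funext fun t => h.flowMap_eq_self hf hcrit t
  rw [hconst] at hp hq
  exact (tendsto_nhds_unique hp tendsto_const_nhds).trans
    (tendsto_nhds_unique hq tendsto_const_nhds).symm

/-- The indicator of the complement of a set of critical points that is closed under connecting
orbits extends to a smooth function which is locally constant near the critical points and is not
increased by the flow. -/
theorem IsPseudoGradient.exists_step (hf : IsMorse n f) (h : IsPseudoGradient X f) (D : Set M)
    (hD : ∀ p q, IsCritical n f p → IsCritical n f q → HasConnectingOrbit X p q → p ∈ D → q ∈ D) :
    ∃ g : M → ℝ, ContMDiff (𝓡 n) 𝓘(ℝ, ℝ) ∞ g ∧ (∀ x, vectorDeriv X g x ≤ 0) ∧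
      ∀ p, IsCritical n f p →
        (p ∈ D → ∀ᶠ x in 𝓝 p, g x = 0) ∧ (p ∉ D → ∀ᶠ x in 𝓝 p, g x = 1) := by
  obtain ⟨V, hV, hDV, hVD, T, hT, htrap⟩ := (h.isGradientLike hf).exists_trapping_nhd (D := D)
    fun x p hp q hq h1 h2 => hD p q hp hq ⟨_, isMIntegralCurve_flowMap h.smooth x, h1, h2⟩
  have hφ : Continuous fun x => flowMap h.smooth (T, x) :=
    (contMDiff_flowMap h.smooth).continuous.comp (by fun_prop)
  have hclosed : IsClosed ((fun x => flowMap h.smooth (T, x)) '' closure V) :=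
    (isClosed_closure.isCompact.image hφ).isClosed
  have hdisj : Disjoint ((fun x => flowMap h.smooth (T, x)) '' closure V) Vᶜ := by
    refine disjoint_left.2 ?_
    rintro _ ⟨x, hx, rfl⟩ hxV
    exact hxV (htrap x hx)
  obtain ⟨u, hu0, hu1, hu⟩ := exists_contMDiffMap_zero_one_nhds_of_isClosed (n := ⊤) (𝓡 n) hclosed
    hV.isClosed_compl hdisj
  have hu0' := eventually_nhdsSet_iff_forall.1 hu0
  have hu1' := eventually_nhdsSet_iff_forall.1 hu1
  obtain ⟨g, hg, hgX, hgc⟩ := exists_vectorDeriv_nonpos_of_flow h.smooth u.contMDiff hT (fun x => by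
    by_cases hx : x ∈ V
    · rw [(hu0' _ ⟨x, subset_closure hx, rfl⟩).self_of_nhds]
      exact (hu x).1
    · rw [(hu1' x hx).self_of_nhds]
      exact (hu _).2)
  refine ⟨g, hg, hgX, fun p hp => ⟨fun hpD => ?_, fun hpD => ?_⟩⟩
  · refine hgc p 0 (h.flowMap_eq_self hf hp) (hu0' p ⟨p, subset_closure (hDV ⟨hp, hpD⟩), ?_⟩)
    exact h.flowMap_eq_self hf hp T
  · exact hgc p 1 (h.flowMap_eq_self hf hp)
      (hu1' p fun hpV => hpD (hVD p hp (subset_closure hpV)))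

/-- Values at the critical points which do not increase along connecting orbits are taken by a
smooth function that is locally constant near the critical points and is not increased by the
flow: such a function is a combination of steps, one for each threshold. -/
theorem IsPseudoGradient.exists_of_values (hf : IsMorse n f) (h : IsPseudoGradient X f) (c : M → ℝ)
    (hc : ∀ p q, IsCritical n f p → IsCritical n f q → HasConnectingOrbit X p q → c q ≤ c p) :
    ∃ g : M → ℝ, ContMDiff (𝓡 n) 𝓘(ℝ, ℝ) ∞ g ∧ (∀ x, vectorDeriv X g x ≤ 0) ∧
      ∀ p, IsCritical n f p → ∀ᶠ x in 𝓝 p, g x = c p := by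
  have hconst (a : ℝ) (x : M) : vectorDeriv X (fun _ => a) x = 0 := by
    rw [vectorDeriv, mfderiv_const]
    rfl
  obtain ⟨T, hT⟩ : ∃ T : Finset ℝ, ∀ p, IsCritical n f p → c p ∈ T :=
    ⟨(hf.finite_setOf_isCritical.image c).toFinset, fun p hp =>
      (Finite.mem_toFinset _).2 ⟨p, hp, rfl⟩⟩
  induction T using Finset.induction_on_max generalizing c with
  | empty =>
    exact ⟨fun _ => 0, contMDiff_const, fun x => (hconst 0 x).le, fun p hp =>
      absurd (hT p hp) (Finset.notMem_empty _)⟩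
  | insert a T ha ih =>
    rcases T.eq_empty_or_nonempty with rfl | hne
    · refine ⟨fun _ => a, contMDiff_const, fun x => (hconst a x).le, fun p hp => ?_⟩
      have hpa : c p = a := by simpa using hT p hp
      exact Eventually.of_forall fun _ => hpa.symm
    · set b := T.max' hne
      have hba : b < a := ha b (T.max'_mem hne)
      obtain ⟨g₁, hg₁, hg₁X, hg₁c⟩ := ih (fun p => min (c p) b)
        (fun p q hp hq hpq => min_le_min_right b (hc p q hp hq hpq)) (fun p hp => by
          rcases Finset.mem_insert.1 (hT p hp) with hpa | hpT
          · rw [hpa, min_eq_right hba.le]; exact T.max'_mem hne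
          · rwa [min_eq_left (T.le_max' _ hpT)])
      obtain ⟨g₂, hg₂, hg₂X, hg₂c⟩ := h.exists_step hf {p | c p < a}
        fun p q hp hq hpq hpa => (hc p q hp hq hpq).trans_lt hpa
      refine ⟨fun x => (a - b) * g₂ x + g₁ x, (contMDiff_const.mul hg₂).add hg₁, fun x => ?_,
        fun p hp => ?_⟩
      · rw [vectorDeriv_const_mul_add X hg₂ hg₁]
        have := mul_nonpos_of_nonneg_of_nonpos (sub_nonneg.2 hba.le) (hg₂X x)
        linarith [hg₁X x]
      · rcases Finset.mem_insert.1 (hT p hp) with hpa | hpT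
        · filter_upwards [hg₁c p hp, (hg₂c p hp).2 hpa.not_lt] with x hx₁ hx₂
          rw [hx₁, hx₂, hpa, min_eq_right hba.le]
          ring
        · filter_upwards [hg₁c p hp, (hg₂c p hp).1 (ha _ hpT)] with x hx₁ hx₂
          rw [hx₁, hx₂, min_eq_left (T.le_max' _ hpT)]
          ring

/-- Functions with a common pseudo-gradient form a convex cone, so that a segment joins `f` to the
modified function. -/
theorem IsPseudoGradient.exists_isMorsePath (hf : IsMorse n f) (h : IsPseudoGradient X f) {ε : ℝ}
    (hε : 0 < ε) (c : M → ℝ)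
    (hc : ∀ p q, IsCritical n f p → IsCritical n f q → HasConnectingOrbit X p q → c q ≤ c p) :
    ∃ F : ℝ → M → ℝ, F 0 = f ∧ IsMorsePath X F ∧
      ∀ p, IsCritical n f p → F 1 p = ε * f p + c p := by
  obtain ⟨g, hg, hgX, hgc⟩ := h.exists_of_values hf c hc
  have hpath : ∀ t ∈ Icc (0 : ℝ) 1, IsMorse n (fun x => (1 - t + t * ε) * f x + t * g x) ∧
      IsPseudoGradient X (fun x => (1 - t + t * ε) * f x + t * g x) := by
    intro t ht
    refine h.const_mul_add hf (g := fun x => t * g x) (contMDiff_const.mul hg) (fun x => ?_) (fun p hp => ?_) ?_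
    · have h1 := vectorDeriv_const_mul_add X hg (contMDiff_const (c := (0 : ℝ))) t x
      have h0 : vectorDeriv X (fun _ => (0 : ℝ)) x = 0 := by
        rw [vectorDeriv, mfderiv_const]
        rfl
      simp only [add_zero, h0] at h1
      rw [h1]
      exact mul_nonpos_of_nonneg_of_nonpos ht.1 (hgX x)
    · refine ⟨t * c p, ?_⟩
      filter_upwards [hgc p hp] with x hx
      rw [hx]
    · rcases ht.1.eq_or_lt with rfl | h0
      · norm_num
      · exact add_pos_of_nonneg_of_pos (sub_nonneg.2 ht.2) (mul_pos h0 hε)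
  refine ⟨fun t x => (1 - t + t * ε) * f x + t * g x, by funext x; simp, ⟨?_, fun t ht =>
    (hpath t ht).1, fun t ht => (hpath t ht).2⟩, fun p hp => ?_⟩
  · have hfst : ContMDiff (𝓘(ℝ, ℝ).prod (𝓡 n)) 𝓘(ℝ, ℝ) ∞ (Prod.fst : ℝ × M → ℝ) := contMDiff_fst
    exact (((((contMDiff_const.sub hfst).add (hfst.mul contMDiff_const)).mul
      (hf.1.comp contMDiff_snd)).add (hfst.mul (hg.comp contMDiff_snd))).contMDiffOn)
  · simp [(hgc p hp).self_of_nhds]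

end MorsePaths

theorem mainTheorem5 (n : ℕ) {M : Type*} [TopologicalSpace M] [T2Space M] [CompactSpace M]
    [ChartedSpace (EuclideanSpace ℝ (Fin n)) M] [IsManifold (𝓡 n) ∞ M]
    (f₀ : M → ℝ) (hf₀ : IsMorse n f₀)
    (X : ∀ x : M, TangentSpace (𝓡 n) x) (hX : IsPseudoGradient X f₀)
    (hconn : ∀ p q, IsCritical n f₀ p → IsCritical n f₀ q →
      morseIndex n f₀ p < morseIndex n f₀ q → ¬ HasConnectingOrbit X p q) :
    (∃ f : ℝ → M → ℝ, f 0 = f₀ ∧ IsMorsePath X f ∧ IsOrdered n (f 1)) ∧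
    ((∃ f : ℝ → M → ℝ, f 0 = f₀ ∧ IsMorsePath X f ∧ IsSelfIndexing n (f 1)) ↔
      ∀ p q, IsCritical n f₀ p → IsCritical n f₀ q → p ≠ q →
        morseIndex n f₀ p = morseIndex n f₀ q → ¬ HasConnectingOrbit X p q) := by
  have hone : (1 : ℝ) ∈ Set.Icc (0 : ℝ) 1 := Set.right_mem_Icc.2 zero_le_one
  have hcrit {f : ℝ → M → ℝ} (hf : IsMorsePath X f) (p : M) :
      IsCritical n (f 1) p ↔ IsCritical n f₀ p :=
    ((hf.pseudoGradient 1 hone).isCritical_iff (hf.morse 1 hone)).trans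
      (hX.isCritical_iff hf₀).symm
  have hindex {f : ℝ → M → ℝ} (hf : IsMorsePath X f) (p : M) (hp : IsCritical n f₀ p) :
      morseIndex n f₀ p = morseIndex n (f 1) p :=
    hX.morseIndex_eq hf₀ (hf.morse 1 hone) (hf.pseudoGradient 1 hone) hp
  obtain ⟨C, hC⟩ : ∃ C, ∀ x, |f₀ x| ≤ C := by
    obtain ⟨C, hC⟩ := isCompact_univ.exists_bound_of_continuousOn hf₀.1.continuous.continuousOn
    exact ⟨C, fun x => hC x (Set.mem_univ x)⟩
  refine ⟨?_, ?_, ?_⟩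
  · -- a multiple of the index exceeding the oscillation of `f₀` is added to the critical values
    obtain ⟨f, hf0, hf, hfv⟩ := hX.exists_isMorsePath hf₀ one_pos
      (fun p => (2 * C + 1) * morseIndex n f₀ p) (fun p q hp hq hpq => by
        have hle : morseIndex n f₀ q ≤ morseIndex n f₀ p :=
          not_lt.1 fun hlt => hconn p q hp hq hlt hpq
        have hle' : (morseIndex n f₀ q : ℝ) ≤ morseIndex n f₀ p := by exact_mod_cast hle
        have hC0 : 0 ≤ C := (abs_nonneg _).trans (hC p)
        exact mul_le_mul_of_nonneg_left hle' (by linarith))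
    refine ⟨f, hf0, hf, fun p q hp hq hlt => ?_⟩
    rw [hcrit hf] at hp hq
    rw [← hindex hf p hp, ← hindex hf q hq] at hlt
    rw [hfv p hp, hfv q hq]
    have hlt' : (morseIndex n f₀ p : ℝ) + 1 ≤ morseIndex n f₀ q := by exact_mod_cast hlt
    have hp' := abs_le.1 (hC p)
    have hq' := abs_le.1 (hC q)
    have hC0 : 0 ≤ C := (abs_nonneg _).trans (hC p)
    nlinarith
  · rintro ⟨f, -, hf, hself⟩ p q hp hq hpq hidx hcon
    have hlt := (hf.pseudoGradient 1 hone).lt_of_hasConnectingOrbit (hf.morse 1 hone) hpq hcon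
    rw [hself p ((hcrit hf p).2 hp), hself q ((hcrit hf q).2 hq), ← hindex hf p hp,
      ← hindex hf q hq, hidx] at hlt
    exact lt_irrefl _ hlt
  · intro hne
    rcases isEmpty_or_nonempty M with hM | ⟨⟨x₀⟩⟩
    · exact ⟨fun _ => f₀, rfl, ⟨hf₀.1.comp_contMDiffOn contMDiffOn_snd, fun _ _ => hf₀, fun _ _ => hX⟩,
        fun p => (hM.false p).elim⟩
    have hC0 : 0 ≤ C := (abs_nonneg _).trans (hC x₀)
    have hε : 0 < (2 * C + 1)⁻¹ := by positivity
    -- `f₀` is scaled so that its oscillation is at most the gap between consecutive indices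
    obtain ⟨f, hf0, hf, hfv⟩ := hX.exists_isMorsePath hf₀ hε
      (fun p => morseIndex n f₀ p - (2 * C + 1)⁻¹ * f₀ p) (fun p q hp hq hpq => by
        rcases eq_or_ne p q with rfl | hpne
        · exact le_rfl
        have hlt : morseIndex n f₀ q < morseIndex n f₀ p :=
          lt_of_le_of_ne (not_lt.1 fun hlt => hconn p q hp hq hlt hpq)
            fun he => hne p q hp hq hpne he.symm hpq
        have hlt' : (morseIndex n f₀ q : ℝ) + 1 ≤ morseIndex n f₀ p := by exact_mod_cast hlt
        have hp' := abs_le.1 (hC p)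
        have hq' := abs_le.1 (hC q)
        have hosc : (2 * C + 1)⁻¹ * (f₀ p - f₀ q) ≤ 1 := by
          rw [inv_mul_le_iff₀ (by positivity)]
          linarith
        rw [mul_sub] at hosc
        linarith)
    refine ⟨f, hf0, hf, fun p hp => ?_⟩
    rw [hcrit hf] at hp
    rw [hfv p hp, ← hindex hf p hp]
    ring
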